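/- Let $p=1$ or let $p\ge 2$ be even. Let $H=\sum_{l=1}^L H_l$, where the $H_l$ are bounded self-adjoint operators on a complex Hilbert space (for instance a system of $n$ qubits), and let $\mathscr U_p(\delta t)$ be the $p$th-order product formula: $\mathscr U_1(\delta t)=e^{-iH_1\delta t}\cdots e^{-iH_L\delta t}$, $\mathscr U_2(\delta t)=e^{-iH_1\delta t/2}\cdots e^{-iH_L\delta t/2}\,e^{-iH_L\delta t/2}\cdots e^{-iH_1\delta t/2}$, and, for $k\ge2$, $\mathscr U_{2k}(\delta t)=\mathscr U_{2k-2}(p_k\delta t)^2\,\mathscr U_{2k-2}((1-4p_k)\delta t)\,\mathscr U_{2k-2}(p_k\delta t)^2$ with $p_k=1/(4-4^{1/(2k-1)})$. Define the multiplicative error $\mathscr M(\delta t)$ by $\mathscr U_p(\delta t)=e^{-iH\delta t}(I+\mathscr M(\delta t))$, its leading coefficient $M=\lim_{\delta t\to0^+}\delta t^{-(p+1)}\mathscr M(\delta t)$, and $\mathscr M_{Re}(\delta t)=\mathscr M(\delta t)-M\,\delta t^{p+1}$. Then: (a) $M=\sum_{l_1,\dots,l_{p+1}=1}^L(-i)^{p+1}c_{l_1\dots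 l_{p+1}}\,[H_{l_1},[H_{l_2},\dots,[H_{l_p},H_{l_{p+1}}]]]$ with real coefficients $c_{l_1\dots l_{p+1}}$ that depend only on $p$, $L$ and the indices. (b) $\|\mathscr M_{Re}(\delta t)\|=\mathcal O\big(\alpha_{p+2}\,\delta t^{p+2}\big)$ as $\delta t\to0^+$, where $\alpha_{p+2}=\sum_{l_1,\dots,l_{p+2}=1}^L\|[H_{l_1},[H_{l_2},\dots,[H_{l_{p+1}},H_{l_{p+2}}]]]\|$; the constant in $\mathcal O$ depends only on $p$, while the range of $\delta t$ may depend on the $H_l$. (c) For every bounded self-adjoint operator $O$, every unit vector $|\psi\rangle$, every integer $r\ge0$ and every $\delta t\ge0$, with $t=r\delta t$ and $\mathscr U_p=\mathscr U_p(\delta t)$, $$\epsilon_O=\big|\langle\psi|\,e^{iHt}Oe^{-iHt}-(\mathscr U_p^\dagger)^{r}\,O\,\mathscr U_p^{\,r}\,|\psi\rangle\big|\le\sum_{k=1}^r\sqrt{C_k}\;\delta t^{p+1}+2r\,\|O\|\,\|\mathscr M_{Re}(\delta t)\|,$$ where $C_k=\langle\psi_k|\,|[O(k\delta t),M]|^2\,|\psi_k\rangle$,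 $|X|^2=X^\dagger X$, $O(k\delta t)=e^{iHk\delta t}Oe^{-iHk\delta t}$ and $|\psi_k\rangle=\mathscr U_p^{\,r-k}|\psi\rangle$. -/

import Mathlib

open Filter Topology

noncomputable section

namespace Trotter

section Algebra

variable {A : Type*} [NormedRing A]

/-- The right-nested commutator `[X₀, [X₁, … [Xₙ₋₁, Xₙ]]]` of `n + 1` elements. -/
def nestedComm : (n : ℕ) → (Fin (n + 1) → A) → A
  | 0, X => X 0
  | n + 1, X => ⁅X 0, nestedComm n (Fin.tail X)⁆

/-- `α_q = ∑ ‖[H_{l₁}, [H_{l₂}, … [H_{l_{q-1}}, H_{l_q}]]]‖` with `q = n + 1`, the sum running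
over all `l₁, …, l_q`. -/
def nestedCommNormSum {L : ℕ} (n : ℕ) (H : Fin L → A) : ℝ :=
  ∑ l : Fin (n + 1) → Fin L, ‖nestedComm n (fun i => H (l i))‖

end Algebra

section Operators

variable {E : Type*} [NormedAddCommGroup E] [InnerProductSpace ℂ E] [CompleteSpace E]

/-- The evolution operator `e^{-i X t}`. -/
def evolution (X : E →L[ℂ] E) (t : ℝ) : E →L[ℂ] E :=
  NormedSpace.exp ((-(Complex.I * (t : ℂ))) • X)

variable {L : ℕ} (H : Fin L → E →L[ℂ] E)

/-- The total Hamiltonian `H = ∑ₗ Hₗ`. -/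
def total : E →L[ℂ] E := ∑ l, H l

/-- `e^{-i H₁ s} e^{-i H₂ s} ⋯ e^{-i H_L s}`. -/
def forwardProd (s : ℝ) : E →L[ℂ] E :=
  (List.ofFn fun l => evolution (H l) s).prod

/-- `e^{-i H_L s} ⋯ e^{-i H₂ s} e^{-i H₁ s}`. -/
def backwardProd (s : ℝ) : E →L[ℂ] E :=
  (List.ofFn fun l => evolution (H l) s).reverse.prod

/-- The Suzuki parameter `p_k = 1 / (4 - 4^{1/(2k-1)})`. -/
def suzukiParam (k : ℕ) : ℝ := 1 / (4 - (4 : ℝ) ^ (1 / (2 * (k : ℝ) - 1)))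

/-- The Suzuki product formula of order `2k` for `k ≥ 1` (the value at `k = 0` is not used). -/
def suzuki : ℕ → ℝ → (E →L[ℂ] E)
  | 0, _ => 1
  | 1, s => forwardProd H (s / 2) * backwardProd H (s / 2)
  | k + 2, s =>
      suzuki (k + 1) (suzukiParam (k + 2) * s) ^ 2 *
        suzuki (k + 1) ((1 - 4 * suzukiParam (k + 2)) * s) *
        suzuki (k + 1) (suzukiParam (k + 2) * s) ^ 2

/-- The product formula `𝒰_p(s)`, for `p = 1` or `p` even and positive. -/
def productFormula (p : ℕ) (s : ℝ) : E →L[ℂ] E :=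
  if p = 1 then forwardProd H s else suzuki H (p / 2) s

/-- The multiplicative error `𝓜(s)`, determined by `𝒰_p(s) = e^{-iHs} (1 + 𝓜(s))`. -/
def mulError (p : ℕ) (s : ℝ) : E →L[ℂ] E :=
  evolution (total H) (-s) * productFormula H p s - 1

/-- The leading coefficient `M` of the multiplicative error: the limit of `𝓜(s) / s^{p+1}` as
`s → 0⁺`. -/
def leadingError (p : ℕ) : E →L[ℂ] E :=
  limUnder (𝓝[>] (0 : ℝ)) fun s => ((s ^ (p + 1))⁻¹ : ℝ) • mulError H p s

/-- The remainder `𝓜_Re(s) = 𝓜(s) - s^{p+1} M`. -/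
def remainder (p : ℕ) (s : ℝ) : E →L[ℂ] E :=
  mulError H p s - (s ^ (p + 1) : ℝ) • leadingError H p

/-- The Heisenberg-evolved observable `O(s) = e^{iHs} O e^{-iHs}`. -/
def heisenberg (O : E →L[ℂ] E) (s : ℝ) : E →L[ℂ] E :=
  evolution (total H) (-s) * O * evolution (total H) s

/-- The expectation `⟨φ| |X|² |φ⟩`, where `|X|² = X† X`. -/
def absSqExpectation (X : E →L[ℂ] E) (φ : E) : ℝ :=
  (inner ℂ φ ((star X * X) φ)).re

/-- `C_k = ⟨ψ_k| |[O(ks), M]|² |ψ_k⟩` with `ψ_k = 𝒰_p(s)^{r-k} ψ`, for `k ≤ r`. -/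
def scrambling (p : ℕ) (O : E →L[ℂ] E) (ψ : E) (r : ℕ) (s : ℝ) (k : ℕ) : ℝ :=
  absSqExpectation ⁅heisenberg H O (k * s), leadingError H p⁆
    ((productFormula H p s ^ (r - k)) ψ)

/-- The observable error
`|⟨ψ| e^{iHt} O e^{-iHt} - (𝒰_p(s)†)^r O 𝒰_p(s)^r |ψ⟩|` at time `t = r s`. -/
def observableError (p : ℕ) (O : E →L[ℂ] E) (ψ : E) (r : ℕ) (s : ℝ) : ℝ :=
  ‖inner ℂ ψ ((heisenberg H O (r * s) -
    star (productFormula H p s) ^ r * O * productFormula H p s ^ r) ψ)‖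

end Operators

end Trotter

end

noncomputable section

namespace Trotter

open Asymptotics NormedSpace

/-! ### Taylor expansions at 0 of vector-valued functions, as big-O statements. -/

section Taylor

variable {V W : Type*} [NormedAddCommGroup V] [NormedSpace ℝ V]
  [NormedAddCommGroup W] [NormedSpace ℝ W]

/-! Put X_l = -i H_l and X = ∑ X_l. Every formula is a product U(s) of exponentials e^{s a X_l}. Its
logarithmic derivative G = U' U⁻¹ is built by the recursion G ↦ a X_l + e^{s a ad X_l} G, so its s^n
coefficient w_n is a real combination of nested commutators of n + 1 letters. The error obeys M' = R
(1 + M), where R = e^{-sX} (G - X) e^{sX}. If M = O(s^{p+1}), then R = O(s^p), and integrating the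
equation gives M = s^{p+1} w_p / (p+1) + s^{p+2} (w_{p+1} - [X, w_p]) / (p+2) + O(s^{p+3})
(`expProdError_expansion`). The first term is (a), and the second is a combination of commutators of
p + 2 letters.

The order condition on M comes from Suzuki's argument: the choice of p_k cancels the leading defect,
and a palindromic product has no defect of even degree.

For (b) the word coefficients must be bounded independently of L. Only factors whose letter occurs
in a word influence its coefficient, and each letter occurs boundedly often in the formula
(`abs_genCoeff_le`). If α_{p+2} > 0, the O(s^{p+3}) term is absorbed for small s. If α_{p+2} = 0,
that absorption fails, but then (ad X_l)^{p+1} X_j = 0; conjugation by e^{tX_l} is isometric, which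
forces [X_l, X_j] = 0, and the formula is exact (`mulError_eq_zero`).

Part (c) is a telescoping over steps: with W = 1 + M unitary and Q = O(kδt), one step contributes Q
- W†QW = -W†[Q, M]. -/

/-- `f(s) = ∑_{k < N} s^k a_k + O(s^N)` as `s → 0`. -/
def HasTaylor (N : ℕ) (f : ℝ → V) (a : ℕ → V) : Prop :=
  (fun s => f s - ∑ k ∈ Finset.range N, s ^ k • a k) =O[𝓝 0] fun s : ℝ => s ^ N

theorem isBigO_pow_smul (n : ℕ) (a : V) :
    (fun s : ℝ => s ^ n • a) =O[𝓝 0] fun s : ℝ => s ^ n :=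
  IsBigO.of_bound ‖a‖ (Eventually.of_forall fun s => by rw [norm_smul, mul_comm])

theorem isBigO_pow_pow {m n : ℕ} (h : m ≤ n) :
    (fun s : ℝ => s ^ n) =O[𝓝 0] fun s : ℝ => s ^ m :=
  IsBigO.of_bound 1 (by
    filter_upwards [Metric.ball_mem_nhds (0 : ℝ) one_pos] with s hs
    have : |s| < 1 := by simpa using hs
    rw [one_mul, norm_pow, norm_pow]
    exact pow_le_pow_of_le_one (norm_nonneg s) this.le h)

theorem HasTaylor.isBigO_one {N : ℕ} {f : ℝ → V} {a : ℕ → V} (h : HasTaylor N f a) :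
    f =O[𝓝 0] fun _ : ℝ => (1 : ℝ) := by
  have h1 : (fun s => f s - ∑ k ∈ Finset.range N, s ^ k • a k) =O[𝓝 0]
      fun _ : ℝ => (1 : ℝ) := by
    simpa using h.trans (isBigO_pow_pow (Nat.zero_le N))
  have h2 : (fun s : ℝ => ∑ k ∈ Finset.range N, s ^ k • a k) =O[𝓝 0]
      fun _ : ℝ => (1 : ℝ) := by
    refine IsBigO.fun_sum fun k _ => ?_
    simpa using (isBigO_pow_smul k (a k)).trans (isBigO_pow_pow (Nat.zero_le k))
  simpa using h1.add h2

theorem HasTaylor.add {N : ℕ} {f g : ℝ → V} {a b : ℕ → V} (hf : HasTaylor N f a)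
    (hg : HasTaylor N g b) : HasTaylor N (fun s => f s + g s) (fun k => a k + b k) := by
  refine (IsBigO.add hf hg).congr_left fun s => ?_
  simp only [smul_add, Finset.sum_add_distrib]
  abel

theorem hasTaylor_const (N : ℕ) (c : V) :
    HasTaylor N (fun _ => c) (fun k => if k = 0 then c else 0) := by
  cases N with
  | zero => simpa [HasTaylor] using isBigO_const_const c (one_ne_zero (α := ℝ)) (𝓝 (0 : ℝ))
  | succ N =>
    refine (isBigO_zero _ _).congr_left fun s => ?_
    simp

theorem HasTaylor.congr_coeff {N : ℕ} {f : ℝ → V} {a b : ℕ → V} (hf : HasTaylor N f a)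
    (hab : ∀ k < N, a k = b k) : HasTaylor N f b := by
  refine IsBigO.congr_left hf fun s => ?_
  congr 1
  exact Finset.sum_congr rfl fun k hk => by rw [hab k (Finset.mem_range.1 hk)]

theorem HasTaylor.mono {N M : ℕ} {f : ℝ → V} {a : ℕ → V} (hf : HasTaylor N f a) (h : M ≤ N) :
    HasTaylor M f a := by
  have h2 : (fun s : ℝ => ∑ k ∈ Finset.Ico M N, s ^ k • a k) =O[𝓝 0] fun s : ℝ => s ^ M :=
    IsBigO.fun_sum fun k hk =>
      (isBigO_pow_smul k (a k)).trans (isBigO_pow_pow (Finset.mem_Ico.1 hk).1)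
  refine ((hf.trans (isBigO_pow_pow h)).add h2).congr_left fun s => ?_
  rw [← Finset.sum_range_add_sum_Ico _ h]
  abel

/-- The Cauchy product for the evaluation of operator-valued functions. -/
theorem HasTaylor.clm_apply {N : ℕ} {T : ℝ → V →L[ℝ] W} {f : ℝ → V} {A : ℕ → V →L[ℝ] W}
    {a : ℕ → V} (hT : HasTaylor N T A) (hf : HasTaylor N f a) :
    HasTaylor N (fun s => T s (f s))
      (fun n => ∑ m ∈ Finset.range (n + 1), A m (a (n - m))) := by
  set P : ℝ → V →L[ℝ] W := fun s => ∑ k ∈ Finset.range N, s ^ k • A k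
  set q : ℝ → V := fun s => ∑ k ∈ Finset.range N, s ^ k • a k
  have hP : P =O[𝓝 0] fun _ : ℝ => (1 : ℝ) := by
    refine IsBigO.fun_sum fun k _ => ?_
    simpa using (isBigO_pow_smul k (A k)).trans (isBigO_pow_pow (Nat.zero_le k))
  have key : ∀ {S : ℝ → V →L[ℝ] W} {g : ℝ → V} {u v : ℝ → ℝ}, S =O[𝓝 0] u → g =O[𝓝 0] v →
      (fun s => S s (g s)) =O[𝓝 0] fun s => u s * v s := by
    intro S g u v hS hg
    refine IsBigO.trans (IsBigO.of_bound 1 (Eventually.of_forall fun s => ?_))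
      (hS.norm_left.mul hg.norm_left)
    rw [one_mul, norm_mul, norm_norm, norm_norm]
    exact (S s).le_opNorm _
  -- Here T f = (T - P) f + P (f - q) + P q, and P q differs from the truncated Cauchy product only
  -- by terms of degree at least N.
  have h1 : (fun s => (T s - P s) (f s)) =O[𝓝 0] fun s : ℝ => s ^ N := by
    simpa only [mul_one] using key hT hf.isBigO_one
  have h2 : (fun s => P s (f s - q s)) =O[𝓝 0] fun s : ℝ => s ^ N := by
    simpa only [one_mul] using key hP hf
  have h3 : (fun s : ℝ => ∑ x ∈ (Finset.range N ×ˢ Finset.range N).filter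
      (fun x => ¬ x.1 + x.2 < N), s ^ (x.1 + x.2) • A x.1 (a x.2)) =O[𝓝 0]
      fun s : ℝ => s ^ N := by
    refine IsBigO.fun_sum fun x hx => ?_
    exact (isBigO_pow_smul _ _).trans (isBigO_pow_pow (not_lt.1 (Finset.mem_filter.1 hx).2))
  refine ((h1.add h2).add h3).congr_left fun s => ?_
  have h4 : P s (q s) = ∑ x ∈ Finset.range N ×ˢ Finset.range N,
      s ^ (x.1 + x.2) • A x.1 (a x.2) := by
    simp only [P, q, Finset.sum_product, map_sum, sum_apply,
      map_smul, smul_apply, Finset.smul_sum, smul_smul, pow_add]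
    rw [Finset.sum_comm]
    refine Finset.sum_congr rfl fun i _ => Finset.sum_congr rfl fun j _ => ?_
    rw [mul_comm]
  have h5 : ∑ x ∈ (Finset.range N ×ˢ Finset.range N).filter (fun x => x.1 + x.2 < N),
      s ^ (x.1 + x.2) • A x.1 (a x.2) =
      ∑ n ∈ Finset.range N, s ^ n • ∑ m ∈ Finset.range (n + 1), A m (a (n - m)) := by
    simp only [Finset.smul_sum]
    rw [Finset.sum_sigma']
    refine Finset.sum_bij' (fun x _ => ⟨x.1 + x.2, x.1⟩) (fun y _ => (y.2, y.1 - y.2))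
      ?_ ?_ ?_ ?_ ?_
    · intro x hx
      simp at hx ⊢
      omega
    · intro y hy
      simp at hy ⊢
      omega
    · intro x hx
      simp
    · rintro ⟨y, z⟩ hy
      simp at hy ⊢
      omega
    · intro x hx
      simp
  rw [← h5]
  have h6 := Finset.sum_filter_add_sum_filter_not (Finset.range N ×ˢ Finset.range N)
    (fun x => x.1 + x.2 < N) (fun x => s ^ (x.1 + x.2) • A x.1 (a x.2))
  rw [← h4] at h6
  simp only [sub_apply, map_sub]
  rw [eq_sub_iff_add_eq.2 h6]
  abel

theorem eq_zero_of_pow_smul_isBigO {n : ℕ} {a : V}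
    (h : (fun s : ℝ => s ^ n • a) =O[𝓝[>] 0] fun s : ℝ => s ^ (n + 1)) : a = 0 := by
  obtain ⟨C, hC⟩ := h.bound
  have h1 : ∀ᶠ s : ℝ in 𝓝[>] 0, ‖a‖ ≤ C * s := by
    filter_upwards [hC, self_mem_nhdsWithin] with s hs h0
    have h0 : 0 < s := h0
    rw [norm_smul, norm_pow, norm_pow, Real.norm_of_nonneg h0.le, pow_succ] at hs
    refine le_of_mul_le_mul_left ?_ (pow_pos h0 n)
    linarith
  have h2 : Tendsto (fun s : ℝ => C * s) (𝓝[>] 0) (𝓝 (C * 0)) :=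
    (tendsto_id.const_mul C).mono_left nhdsWithin_le_nhds
  have h3 := ge_of_tendsto h2 h1
  rw [mul_zero] at h3
  exact norm_le_zero_iff.1 h3

/-- Uniqueness of Taylor coefficients: the lowest nonzero one would violate the decay rate. -/
theorem HasTaylor.coeff_eq_zero {N m : ℕ} {f : ℝ → V} {a : ℕ → V} (hf : HasTaylor N f a)
    (hm : m ≤ N) (h : f =O[𝓝 0] fun s : ℝ => s ^ m) : ∀ k < m, a k = 0 := by
  intro k
  induction k using Nat.strong_induction_on with
  | _ k ih =>
    intro hk
    have h1 := hf.mono (M := k + 1) (by omega)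
    have h2 := (h.trans (isBigO_pow_pow (m := k + 1) (by omega))).sub h1
    refine eq_zero_of_pow_smul_isBigO (n := k) ((h2.mono nhdsWithin_le_nhds).congr_left
      fun s => ?_)
    rw [Finset.sum_range_succ, Finset.sum_eq_zero]
    · abel
    · intro j hj
      rw [ih j (Finset.mem_range.1 hj) (by have := Finset.mem_range.1 hj; omega), smul_zero]

/-- Integration of an O-estimate through the mean value inequality; the factor 1/(n+1) is not
needed. -/
theorem isBigO_pow_succ_of_deriv {f f' : ℝ → V} {n : ℕ} (hf : ∀ s, HasDerivAt f (f' s) s)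
    (h0 : f 0 = 0) (h : f' =O[𝓝 0] fun s : ℝ => s ^ n) :
    f =O[𝓝 0] fun s : ℝ => s ^ (n + 1) := by
  obtain ⟨C, hC0, hC⟩ := h.exists_pos
  obtain ⟨ε, hε, hb⟩ := Metric.eventually_nhds_iff_ball.1 hC.bound
  refine IsBigO.of_bound C ?_
  filter_upwards [Metric.ball_mem_nhds (0 : ℝ) hε] with s hs
  have hs' : |s| < ε := by simpa using hs
  have key := Convex.norm_image_sub_le_of_norm_hasDerivWithin_le (f := f) (f' := f')
    (s := Metric.closedBall (0 : ℝ) |s|) (x := 0) (y := s) (C := C * |s| ^ n)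
    (fun x _ => (hf x).hasDerivWithinAt) (fun x hx => ?_) (convex_closedBall _ _)
    (by simp) (by simp)
  · rw [h0, sub_zero, sub_zero] at key
    rw [norm_pow, pow_succ, ← mul_assoc]
    exact key
  · have hx' : |x| ≤ |s| := by simpa using hx
    refine (hb x (by simpa using hx'.trans_lt hs')).trans ?_
    rw [norm_pow, Real.norm_eq_abs]
    gcongr

end Taylor

/-! ### One-parameter exponentials and conjugation as the exponential of ad. -/

section Exp

variable {A : Type*} [NormedRing A] [NormedAlgebra ℝ A] [CompleteSpace A]

theorem exp_add_smul (X : A) (s t : ℝ) : exp ((s + t) • X) = exp (s • X) * exp (t • X) := by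
  let _ : NormedAlgebra ℚ A := NormedAlgebra.restrictScalars ℚ ℝ A
  rw [add_smul, exp_add_of_commute ((Commute.refl X).smul_left s |>.smul_right t)]

theorem exp_neg_smul_mul (X : A) (s : ℝ) : exp (-s • X) * exp (s • X) = 1 := by
  rw [← exp_add_smul, neg_add_cancel, zero_smul, exp_zero]

theorem exp_smul_mul_neg (X : A) (s : ℝ) : exp (s • X) * exp (-s • X) = 1 := by
  rw [← exp_add_smul, add_neg_cancel, zero_smul, exp_zero]

theorem hasTaylor_exp (N : ℕ) (X : A) :
    HasTaylor N (fun s : ℝ => exp (s • X)) (fun k => ((k.factorial : ℝ)⁻¹) • X ^ k) := by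
  have h := (exp_hasFPowerSeriesAt_zero (𝕂 := ℝ) (𝔸 := A)).isBigO_sub_partialSum_pow N
  have ht : Tendsto (fun s : ℝ => s • X) (𝓝 0) (𝓝 0) := by
    have : Continuous fun s : ℝ => s • X := by fun_prop
    simpa using this.tendsto 0
  have h2 := h.comp_tendsto ht
  have h3 : (fun s : ℝ => ‖s • X‖ ^ N) =O[𝓝 0] fun s : ℝ => s ^ N := by
    have : (fun s : ℝ => s • X) =O[𝓝 0] fun s : ℝ => s := by
      simpa using isBigO_pow_smul 1 X
    exact this.norm_left.pow N
  refine (h2.trans h3).congr_left fun s => ?_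
  simp only [Function.comp_apply, zero_add, FormalMultilinearSeries.partialSum,
    expSeries_apply_eq, smul_pow]
  congr 1
  exact Finset.sum_congr rfl fun k _ => smul_comm _ _ _

end Exp

section Ad

variable {A : Type*} [NormedRing A] [NormedAlgebra ℝ A]

/-- The bounded operator `Y ↦ [X, Y]`. -/
def adCLM (X : A) : A →L[ℝ] A :=
  ContinuousLinearMap.mul ℝ A X - (ContinuousLinearMap.mul ℝ A).flip X

@[simp] theorem adCLM_apply (X Y : A) : adCLM X Y = ⁅X, Y⁆ := rfl

variable [CompleteSpace A]

/-- Conjugating the left side back by e^{-tX} gives a function of t with zero derivative. The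
identity turns the Taylor series of a conjugation into iterated commutators. -/
theorem exp_adCLM_apply (X Z : A) (t : ℝ) :
    exp (t • adCLM X) Z = exp (t • X) * Z * exp (-t • X) := by
  let _ : NormedAlgebra ℚ A := NormedAlgebra.restrictScalars ℚ ℝ A
  have hd : ∀ u : ℝ, HasDerivAt
      (fun u : ℝ => exp (-u • X) * (exp (u • adCLM X) Z) * exp (u • X)) 0 u := by
    intro u
    have h1 : HasDerivAt (fun u : ℝ => exp (-u • X)) (-(exp (-u • X) * X)) u := by
      have := (hasDerivAt_exp_smul_const X (-u)).scomp u (hasDerivAt_neg u)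
      simpa [Function.comp_def] using this
    have h2 : HasDerivAt (fun u : ℝ => exp (u • adCLM X) Z) (⁅X, exp (u • adCLM X) Z⁆) u := by
      have := (hasDerivAt_exp_smul_const' (𝕂 := ℝ) (adCLM X) u).clm_apply
        (hasDerivAt_const u Z)
      simpa using this
    have h3 := hasDerivAt_exp_smul_const' X u
    have h4 := (h1.mul h2).mul h3
    refine h4.congr_deriv ?_
    simp only [Ring.lie_def, Pi.mul_apply]
    noncomm_ring
  have hc := is_const_of_deriv_eq_zero (fun u => (hd u).differentiableAt)
    (fun u => (hd u).deriv) t 0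
  have h0 : exp ((0 : ℝ) • adCLM X) Z = Z := by
    rw [zero_smul ℝ (adCLM X), exp_zero]
    rfl
  simp only [neg_zero, zero_smul ℝ X, exp_zero, one_mul, mul_one, h0] at hc
  have h5 := congrArg (fun Y => exp (t • X) * Y * exp (-t • X)) hc
  simp only [mul_assoc, exp_smul_mul_neg, mul_one] at h5
  rw [← mul_assoc, exp_smul_mul_neg, one_mul] at h5
  rw [h5, mul_assoc]

end Ad

/-! ### Coefficients of nested commutators indexed by words, and bounds uniform in the number of
letters. -/

section Words

variable {L : ℕ}

/-- Coefficients on words, moved to the words that begin with the letter `l`. -/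
def consLetter (l : Fin L) (g : List (Fin L) → ℝ) : List (Fin L) → ℝ
  | [] => 0
  | x :: w => if x = l then g w else 0

/-- The coefficients of the logarithmic derivative of `e^{s a₁ X_{l₁}} e^{s a₂ X_{l₂}} ⋯` on nested
commutators, indexed by words. The factors are listed as pairs `(lⱼ, aⱼ)`. -/
def genCoeff : List (Fin L × ℝ) → List (Fin L) → ℝ
  | [], _ => 0
  | x :: F, w => (if w = [x.1] then x.2 else 0) +
      ∑ m ∈ Finset.range w.length,
        (((m.factorial : ℝ)⁻¹ * x.2 ^ m) * (consLetter x.1)^[m] (genCoeff F) w)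

theorem consLetter_iterate_of_notMem {l : Fin L} {g : List (Fin L) → ℝ} {w : List (Fin L)}
    (h : l ∉ w) {m : ℕ} (hm : m ≠ 0) : (consLetter l)^[m] g w = 0 := by
  obtain ⟨m, rfl⟩ := Nat.exists_eq_succ_of_ne_zero hm
  rw [Function.iterate_succ_apply']
  cases w with
  | nil => rfl
  | cons x w =>
    rw [consLetter, if_neg]
    rintro rfl
    exact h List.mem_cons_self

theorem abs_consLetter_iterate_le {l : Fin L} {g : List (Fin L) → ℝ} {B : ℝ} (hB : 0 ≤ B)
    {w : List (Fin L)} (h : ∀ v, v <:+ w → |g v| ≤ B) (m : ℕ) :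
    |(consLetter l)^[m] g w| ≤ B := by
  induction m generalizing w with
  | zero => exact h w List.suffix_rfl
  | succ m ih =>
    rw [Function.iterate_succ_apply']
    cases w with
    | nil => simpa [consLetter] using hB
    | cons x w =>
      rw [consLetter]
      split_ifs with hx
      · exact ih fun v hv => h v (hv.trans (List.suffix_cons x w))
      · simpa using hB

/-- Prepending a factor whose letter is absent from w leaves the coefficient of w unchanged. A
factor whose letter is present multiplies the bound by at most b + n b^n: b from the new one-letter
word and b^n from each of at most n powers of ad. Suffixes of w enter the recursion, so the bound is
stated for all short words. -/
theorem abs_genCoeff_le_pow_countP {b : ℝ} (hb : 1 ≤ b) (n : ℕ) (F : List (Fin L × ℝ))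
    (hF : ∀ x ∈ F, |x.2| ≤ b) (w : List (Fin L)) (hw : w.length ≤ n) :
    |genCoeff F w| ≤ (b + n * b ^ n) ^ (F.countP fun x => x.1 ∈ w) := by
  have hD : 1 ≤ b + n * b ^ n := by
    have : 0 ≤ (n : ℝ) * b ^ n := by positivity
    linarith
  induction F generalizing w with
  | nil => simp [genCoeff]
  | cons x F ih =>
    have ihF := fun v hv => ih (fun y hy => hF y (List.mem_cons_of_mem _ hy)) v hv
    by_cases hx : x.1 ∈ w
    · rw [List.countP_cons_of_pos (by simpa using hx), pow_succ]
      set q := F.countP fun x => x.1 ∈ w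
      have hq : 1 ≤ (b + n * b ^ n) ^ q := one_le_pow₀ hD
      have hsuf : ∀ v, v <:+ w → |genCoeff F v| ≤ (b + n * b ^ n) ^ q := fun v hv =>
        (ihF v (hv.length_le.trans hw)).trans (pow_le_pow_right₀ hD
          (List.countP_mono_left fun y _ hy => by
            simp only [decide_eq_true_eq] at hy ⊢
            exact hv.subset hy))
      have hxb : |x.2| ≤ b := hF x List.mem_cons_self
      have h1 : |if w = [x.1] then x.2 else 0| ≤ b := by
        split_ifs
        · exact hxb
        · simpa using (zero_le_one.trans hb)
      have h2 : ∀ m ∈ Finset.range w.length,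
          |((m.factorial : ℝ)⁻¹ * x.2 ^ m) * (consLetter x.1)^[m] (genCoeff F) w| ≤
            b ^ n * (b + n * b ^ n) ^ q := by
        intro m hm
        have hmn : m ≤ n := (Finset.mem_range.1 hm).le.trans hw
        rw [abs_mul]
        refine mul_le_mul ?_ (abs_consLetter_iterate_le (by positivity) hsuf m)
          (abs_nonneg _) (by positivity)
        rw [abs_mul, abs_pow, abs_of_nonneg (by positivity : (0 : ℝ) ≤ (m.factorial : ℝ)⁻¹)]
        have hf : ((m.factorial : ℝ)⁻¹) ≤ 1 :=
          inv_le_one_of_one_le₀ (by exact_mod_cast Nat.one_le_iff_ne_zero.2 m.factorial_ne_zero)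
        calc ((m.factorial : ℝ)⁻¹) * |x.2| ^ m ≤ 1 * b ^ m := by gcongr
          _ ≤ b ^ n := by rw [one_mul]; exact pow_le_pow_right₀ hb hmn
      rw [genCoeff]
      calc _ ≤ b + ∑ m ∈ Finset.range w.length, b ^ n * (b + n * b ^ n) ^ q :=
            (abs_add_le _ _).trans (add_le_add h1
              ((Finset.abs_sum_le_sum_abs _ _).trans (Finset.sum_le_sum h2)))
        _ ≤ b * (b + n * b ^ n) ^ q + n * (b ^ n * (b + n * b ^ n) ^ q) := by
            rw [Finset.sum_const, Finset.card_range, nsmul_eq_mul]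
            have hw' : (w.length : ℝ) ≤ n := by exact_mod_cast hw
            gcongr
            exact le_mul_of_one_le_right (by positivity) hq
        _ = _ := by ring
    · rw [List.countP_cons_of_neg (by simpa using hx)]
      have h1 : w ≠ [x.1] := by
        rintro rfl
        exact hx List.mem_cons_self
      rw [genCoeff, if_neg h1, zero_add]
      cases hl : w.length with
      | zero => simpa using zero_le_one.trans (one_le_pow₀ hD)
      | succ k =>
        -- Only m = 0 survives, since `consLetter` needs the letter at the head of w; that term is
        -- the coefficient for the shorter list.
        rw [Finset.sum_range_succ', Finset.sum_eq_zero fun m _ => by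
          rw [consLetter_iterate_of_notMem hx (Nat.succ_ne_zero m), mul_zero]]
        simpa using ihF w hw

theorem countP_mem_le (F : List (Fin L × ℝ)) {K : ℕ}
    (hK : ∀ l, F.countP (fun x => x.1 = l) ≤ K) (w : List (Fin L)) :
    F.countP (fun x => x.1 ∈ w) ≤ w.length * K := by
  induction w with
  | nil => simp
  | cons l w ih =>
    have h : ∀ G : List (Fin L × ℝ), G.countP (fun x => x.1 ∈ l :: w) ≤
        G.countP (fun x => x.1 = l) + G.countP (fun x => x.1 ∈ w) := by
      intro G
      induction G with
      | nil => simp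
      | cons y G ihG =>
        simp only [List.countP_cons, List.mem_cons, decide_eq_true_eq] at ihG ⊢
        by_cases h1 : y.1 = l <;> by_cases h2 : y.1 ∈ w <;> simp [h1, h2] <;> grind
    refine (h F).trans ?_
    rw [List.length_cons, Nat.succ_mul, add_comm]
    exact add_le_add ih (hK l)

/-- The word coefficients are bounded independently of the number of letters. -/
theorem abs_genCoeff_le {b : ℝ} (hb : 1 ≤ b) (n K : ℕ) (F : List (Fin L × ℝ))
    (hF : ∀ x ∈ F, |x.2| ≤ b) (hK : ∀ l, F.countP (fun x => x.1 = l) ≤ K)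
    (w : List (Fin L)) (hw : w.length ≤ n) :
    |genCoeff F w| ≤ (b + n * b ^ n) ^ (n * K) := by
  refine (abs_genCoeff_le_pow_countP hb n F hF w hw).trans (pow_le_pow_right₀ ?_ ?_)
  · have : 0 ≤ (n : ℝ) * b ^ n := by positivity
    linarith
  · exact (countP_mem_le F hK w).trans (Nat.mul_le_mul_right K hw)

variable {A : Type*} [NormedRing A]

theorem nestedComm_cons (X : Fin L → A) (n : ℕ) (l : Fin L) (v : Fin (n + 1) → Fin L) :
    nestedComm (n + 1) (fun i => X ((Fin.cons l v : Fin (n + 2) → Fin L) i)) =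
      ⁅X l, nestedComm n (fun i => X (v i))⁆ := by
  rw [nestedComm]
  rfl

variable [NormedAlgebra ℝ A]

/-- The linear combination of the nested commutators of `n + 1` letters with coefficients `g`. -/
def wordSum (X : Fin L → A) (g : List (Fin L) → ℝ) (n : ℕ) : A :=
  ∑ w : Fin (n + 1) → Fin L, g (List.ofFn w) • nestedComm n (fun i => X (w i))

theorem sum_word_succ (n : ℕ) {B : Type*} [AddCommMonoid B] (f : (Fin (n + 1) → Fin L) → B) :
    ∑ w, f w = ∑ l : Fin L, ∑ v : Fin n → Fin L, f (Fin.cons l v) := by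
  rw [← Fintype.sum_prod_type', ← (Fin.consEquiv fun _ => Fin L).sum_comp]
  rfl

theorem wordSum_consLetter (X : Fin L → A) (l : Fin L) (g : List (Fin L) → ℝ) (n : ℕ) :
    wordSum X (consLetter l g) (n + 1) = adCLM (X l) (wordSum X g n) := by
  rw [wordSum, sum_word_succ, Finset.sum_eq_single l]
  · simp only [wordSum, map_sum, map_smul, nestedComm_cons, List.ofFn_succ, Fin.cons_zero,
      Fin.cons_succ, consLetter, if_true, adCLM_apply]
  · intro x _ hx
    refine Finset.sum_eq_zero fun v _ => ?_
    rw [List.ofFn_succ, consLetter, Fin.cons_zero, if_neg hx, zero_smul]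
  · simp

theorem wordSum_consLetter_iterate (X : Fin L → A) (l : Fin L) (g : List (Fin L) → ℝ)
    (n m : ℕ) :
    wordSum X ((consLetter l)^[m] g) (n + m) = (adCLM (X l) ^ m) (wordSum X g n) := by
  induction m with
  | zero => simp
  | succ m ih =>
    rw [Function.iterate_succ_apply', ← add_assoc, wordSum_consLetter, ih, pow_succ']
    rfl

theorem smul_clm_pow_apply (a : ℝ) (T : A →L[ℝ] A) (m : ℕ) (y : A) :
    ((a • T) ^ m) y = a ^ m • (T ^ m) y := by
  induction m with
  | zero => simp
  | succ m ih =>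
    rw [pow_succ', pow_succ', pow_succ', mul_apply_eq_comp,
      mul_apply_eq_comp, ih, smul_apply, map_smul, smul_smul]

/-- This is the coefficientwise form of G ↦ a X_l + e^{s a ad X_l} G, with the degree in s one less
than the word length. -/
theorem wordSum_genCoeff_cons (X : Fin L → A) (x : Fin L × ℝ) (F : List (Fin L × ℝ)) (n : ℕ) :
    wordSum X (genCoeff (x :: F)) n = (if n = 0 then x.2 • X x.1 else 0) +
      ∑ m ∈ Finset.range (n + 1),
        (((m.factorial : ℝ)⁻¹) • (x.2 • adCLM (X x.1)) ^ m) (wordSum X (genCoeff F) (n - m)) := by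
  have h1 : wordSum X (genCoeff (x :: F)) n =
      (∑ w : Fin (n + 1) → Fin L, (if List.ofFn w = [x.1] then x.2 else 0) •
        nestedComm n (fun i => X (w i))) +
      ∑ m ∈ Finset.range (n + 1), ((m.factorial : ℝ)⁻¹ * x.2 ^ m) •
        wordSum X ((consLetter x.1)^[m] (genCoeff F)) n := by
    simp only [wordSum, genCoeff, List.length_ofFn, add_smul, Finset.sum_add_distrib,
      Finset.sum_smul, Finset.smul_sum, mul_smul]
    rw [Finset.sum_comm]
  rw [h1]
  congr 1
  · cases n with
    | zero =>
      rw [if_pos rfl, sum_word_succ, Finset.sum_eq_single x.1]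
      · simp [nestedComm]
      · intro y _ hy
        simp [hy]
      · simp
    | succ n => simp
  · refine Finset.sum_congr rfl fun m hm => ?_
    have hmn : m ≤ n := Nat.lt_succ_iff.1 (Finset.mem_range.1 hm)
    conv_lhs => rw [← Nat.sub_add_cancel hmn]
    rw [wordSum_consLetter_iterate, mul_smul, ← smul_clm_pow_apply]
    rfl

theorem norm_wordSum_le (X : Fin L → A) {g : List (Fin L) → ℝ} {n : ℕ} {B : ℝ}
    (hg : ∀ w, w.length = n + 1 → |g w| ≤ B) :
    ‖wordSum X g n‖ ≤ B * nestedCommNormSum n X := by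
  rw [wordSum, nestedCommNormSum, Finset.mul_sum]
  refine (norm_sum_le _ _).trans (Finset.sum_le_sum fun w _ => ?_)
  rw [norm_smul]
  exact mul_le_mul_of_nonneg_right (hg _ (List.length_ofFn)) (norm_nonneg _)

/-- The bracket with ∑ X_l prepends every letter with coefficient 1, so words grow by one letter and
the bound B persists. -/
theorem norm_lie_wordSum_le (X : Fin L → A) {g : List (Fin L) → ℝ} {n : ℕ} {B : ℝ}
    (hg : ∀ w, w.length = n + 1 → |g w| ≤ B) :
    ‖⁅∑ l, X l, wordSum X g n⁆‖ ≤ B * nestedCommNormSum (n + 1) X := by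
  have h0 : ⁅∑ l, X l, wordSum X g n⁆ = ∑ l, ⁅X l, wordSum X g n⁆ := by
    simp only [Ring.lie_def, Finset.sum_mul, Finset.mul_sum, Finset.sum_sub_distrib]
  rw [nestedCommNormSum, sum_word_succ, h0, wordSum, Finset.mul_sum]
  refine (norm_sum_le _ _).trans (Finset.sum_le_sum fun l _ => ?_)
  have h : ⁅X l, ∑ w : Fin (n + 1) → Fin L, g (List.ofFn w) • nestedComm n (fun i => X (w i))⁆ =
      ∑ w : Fin (n + 1) → Fin L, g (List.ofFn w) • ⁅X l, nestedComm n (fun i => X (w i))⁆ := by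
    simp only [← adCLM_apply, map_sum, map_smul]
  rw [h, Finset.mul_sum]
  refine (norm_sum_le _ _).trans (Finset.sum_le_sum fun w _ => ?_)
  rw [norm_smul, nestedComm_cons]
  exact mul_le_mul_of_nonneg_right (hg _ (List.length_ofFn)) (norm_nonneg _)

end Words

/-! ### Logarithmic derivatives of products of exponentials and the equation for the error. -/

section Generator

variable {L : ℕ} {A : Type*} [NormedRing A] [NormedAlgebra ℝ A]

/-- The product `e^{s a₁ X_{l₁}} e^{s a₂ X_{l₂}} ⋯` over a list of pairs `(lⱼ, aⱼ)`. -/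
def expProd (X : Fin L → A) (F : List (Fin L × ℝ)) (s : ℝ) : A :=
  (F.map fun x => exp ((s * x.2) • X x.1)).prod

theorem expProd_cons (X : Fin L → A) (x : Fin L × ℝ) (F : List (Fin L × ℝ)) (s : ℝ) :
    expProd X (x :: F) s = exp ((s * x.2) • X x.1) * expProd X F s := by
  simp [expProd]

theorem expProd_append (X : Fin L → A) (F G : List (Fin L × ℝ)) (s : ℝ) :
    expProd X (F ++ G) s = expProd X F s * expProd X G s := by
  simp [expProd]

/-- The logarithmic derivative `U'(s) U(s)⁻¹` of a product of exponentials. -/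
def generator (X : Fin L → A) : List (Fin L × ℝ) → ℝ → A
  | [], _ => 0
  | x :: F, s => x.2 • X x.1 +
      exp ((s * x.2) • X x.1) * generator X F s * exp (-(s * x.2) • X x.1)

/-- The multiplicative error of a product of exponentials with respect to `e^{s ∑ Xₗ}`. -/
def expProdError (X : Fin L → A) (F : List (Fin L × ℝ)) (s : ℝ) : A :=
  exp (-s • ∑ l, X l) * expProd X F s - 1

/-- The logarithmic derivative of `1 + expProdError`. -/
def errorGenerator (X : Fin L → A) (F : List (Fin L × ℝ)) (s : ℝ) : A :=
  exp (-s • ∑ l, X l) * (generator X F s - ∑ l, X l) * exp (s • ∑ l, X l)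

/-- The Taylor coefficients of `generator X F - ∑ l, X l`. -/
def defectCoeff (X : Fin L → A) (F : List (Fin L × ℝ)) (n : ℕ) : A :=
  wordSum X (genCoeff F) n + if n = 0 then -∑ l, X l else 0

theorem expProdError_zero (X : Fin L → A) (F : List (Fin L × ℝ)) : expProdError X F 0 = 0 := by
  have h : expProd X F 0 = 1 := by simp [expProd]
  simp [expProdError, h]

variable [CompleteSpace A]

/-- Reversing both order and time inverts a product of exponentials; for a palindromic list this is
time symmetry. -/
theorem expProd_mul_reverse (X : Fin L → A) (F : List (Fin L × ℝ)) (s : ℝ) :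
    expProd X F s * expProd X F.reverse (-s) = 1 := by
  induction F with
  | nil => simp [expProd]
  | cons x F ih =>
    rw [List.reverse_cons, expProd_append, expProd_cons, mul_assoc, ← mul_assoc _ _ (expProd X [x] _),
      ih, one_mul, expProd_cons]
    simpa [expProd] using exp_smul_mul_neg (X x.1) (s * x.2)

theorem hasDerivAt_expProd (X : Fin L → A) (F : List (Fin L × ℝ)) (s : ℝ) :
    HasDerivAt (expProd X F) (generator X F s * expProd X F s) s := by
  induction F with
  | nil =>
    have h : expProd X [] = fun _ => (1 : A) := rfl
    simpa [h, generator] using hasDerivAt_const s (1 : A)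
  | cons x F ih =>
    have h1 : HasDerivAt (fun u : ℝ => exp ((u * x.2) • X x.1))
        (x.2 • X x.1 * exp ((s * x.2) • X x.1)) s := by
      have := (hasDerivAt_exp_smul_const' (X x.1) (s * x.2)).scomp s
        ((hasDerivAt_id s).mul_const x.2)
      simpa [Function.comp_def] using this
    have h2 := h1.mul ih
    have h3 : expProd X (x :: F) = (fun u : ℝ => exp ((u * x.2) • X x.1)) * expProd X F :=
      funext fun u => expProd_cons X x F u
    rw [h3]
    refine h2.congr_deriv ?_
    rw [Pi.mul_apply, generator, add_mul]
    congr 1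
    · rw [mul_assoc]
    · simp only [mul_assoc]
      rw [← mul_assoc (exp (-(s * x.2) • X x.1)), exp_neg_smul_mul, one_mul]

theorem hasTaylor_generator (N : ℕ) (X : Fin L → A) (F : List (Fin L × ℝ)) :
    HasTaylor N (generator X F) (wordSum X (genCoeff F)) := by
  induction F with
  | nil =>
    have h : generator X [] = fun _ => (0 : A) := rfl
    rw [h]
    refine (hasTaylor_const N (0 : A)).congr_coeff fun k _ => ?_
    simp [wordSum, genCoeff]
  | cons x F ih =>
    have h1 := (hasTaylor_const N (x.2 • X x.1)).add
      ((hasTaylor_exp N (x.2 • adCLM (X x.1))).clm_apply ih)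
    have h2 : generator X (x :: F) = fun s => x.2 • X x.1 +
        exp (s • x.2 • adCLM (X x.1)) (generator X F s) := by
      funext s
      rw [smul_smul, exp_adCLM_apply]
      rfl
    rw [h2]
    exact h1.congr_coeff fun k _ => (wordSum_genCoeff_cons X x F k).symm

theorem hasDerivAt_expProdError (X : Fin L → A) (F : List (Fin L × ℝ)) (s : ℝ) :
    HasDerivAt (expProdError X F)
      (errorGenerator X F s * (1 + expProdError X F s)) s := by
  have h1 : HasDerivAt (fun u : ℝ => exp (-u • ∑ l, X l))
      (-(exp (-s • ∑ l, X l) * ∑ l, X l)) s := by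
    have := (hasDerivAt_exp_smul_const (∑ l, X l) (-s)).scomp s (hasDerivAt_neg s)
    simpa [Function.comp_def] using this
  refine ((h1.mul (hasDerivAt_expProd X F s)).sub_const 1).congr_deriv ?_
  rw [errorGenerator, expProdError, add_sub_cancel, mul_assoc _ (exp (s • _)),
    ← mul_assoc (exp (s • _)), exp_smul_mul_neg, one_mul]
  noncomm_ring

theorem hasTaylor_defect (N : ℕ) (X : Fin L → A) (F : List (Fin L × ℝ)) :
    HasTaylor N (fun s => generator X F s - ∑ l, X l) (defectCoeff X F) := by
  simp only [sub_eq_add_neg]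
  exact (hasTaylor_generator N X F).add (hasTaylor_const N (-∑ l, X l))

theorem hasTaylor_errorGenerator (N : ℕ) (X : Fin L → A) (F : List (Fin L × ℝ)) :
    HasTaylor N (errorGenerator X F) (fun n => ∑ m ∈ Finset.range (n + 1),
      (((m.factorial : ℝ)⁻¹) • (-adCLM (∑ l, X l)) ^ m) (defectCoeff X F (n - m))) := by
  have h1 := (hasTaylor_exp N (-adCLM (∑ l, X l))).clm_apply (hasTaylor_defect N X F)
  have h2 : errorGenerator X F = fun s => exp (s • -adCLM (∑ l, X l))
      (generator X F s - ∑ l, X l) := by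
    funext s
    rw [smul_neg, ← neg_smul, exp_adCLM_apply, neg_neg]
    rfl
  rw [h2]
  exact h1

end Generator

/-! ### From the order of the error to its two leading terms. -/

section Expansion

variable {L : ℕ} {A : Type*} [NormedRing A] [NormedAlgebra ℝ A]

theorem wordSum_genCoeff_zero (X : Fin L → A) (F : List (Fin L × ℝ)) :
    wordSum X (genCoeff F) 0 = (F.map fun x => x.2 • X x.1).sum := by
  induction F with
  | nil => simp [wordSum, genCoeff]
  | cons x F ih =>
    rw [wordSum_genCoeff_cons, List.map_cons, List.sum_cons, ← ih]
    simp

theorem hasDerivAt_pow_smul (n : ℕ) (a : A) (s : ℝ) :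
    HasDerivAt (fun s : ℝ => s ^ (n + 1) • ((n + 1 : ℝ)⁻¹ • a)) (s ^ n • a) s := by
  refine ((hasDerivAt_pow (n + 1) s).smul_const _).congr_deriv ?_
  rw [smul_smul, Nat.add_sub_cancel]
  congr 1
  push_cast
  field_simp

variable [CompleteSpace A]

theorem isBigO_exp_smul_one (X : A) (a : ℝ) :
    (fun s : ℝ => exp ((s * a) • X)) =O[𝓝 0] fun _ : ℝ => (1 : ℝ) := by
  simpa only [smul_smul] using (hasTaylor_exp 0 (a • X)).isBigO_one

theorem isBigO_exp_smul_sub_one (X : A) (a : ℝ) :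
    (fun s : ℝ => exp ((s * a) • X) - 1) =O[𝓝 0] fun s : ℝ => s := by
  have h := hasTaylor_exp 1 (a • X)
  simpa [HasTaylor, smul_smul] using h

/-- Bootstrap on n: if R = s^n r + O(s^{n+1}), then integrating M' = R + R M gives M = s^{n+1} r /
(n+1) + O(s^{n+2}). As n < p, M is itself O(s^{n+2}), hence r = 0. -/
theorem errorGenerator_isBigO (X : Fin L → A) (F : List (Fin L × ℝ)) {p : ℕ}
    (h : expProdError X F =O[𝓝 0] fun s : ℝ => s ^ (p + 1)) :
    errorGenerator X F =O[𝓝 0] fun s : ℝ => s ^ p := by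
  suffices ∀ n ≤ p, errorGenerator X F =O[𝓝 0] fun s : ℝ => s ^ n from this p le_rfl
  intro n
  induction n with
  | zero => intro _; simpa using (hasTaylor_errorGenerator 0 X F).isBigO_one
  | succ n ih =>
    intro hn
    have hR := ih (by omega)
    obtain ⟨r, hr⟩ : ∃ r, HasTaylor (n + 1) (errorGenerator X F) r :=
      ⟨_, hasTaylor_errorGenerator (n + 1) X F⟩
    have hr0 := hr.coeff_eq_zero (Nat.le_succ n) hR
    have hr1 : (fun s => errorGenerator X F s - s ^ n • r n) =O[𝓝 0]
        fun s : ℝ => s ^ (n + 1) := by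
      refine IsBigO.congr_left hr fun s => ?_
      rw [Finset.sum_range_succ, Finset.sum_eq_zero fun k hk => by
        rw [hr0 k (Finset.mem_range.1 hk), smul_zero], zero_add]
    have hm : (fun s => errorGenerator X F s * expProdError X F s) =O[𝓝 0]
        fun s : ℝ => s ^ (n + 1) := by
      have := hR.mul (h.trans (isBigO_pow_pow (m := 1) (by omega)))
      simpa only [← pow_add] using this
    have hd := isBigO_pow_succ_of_deriv (n := n + 1)
      (f := fun s => expProdError X F s - s ^ (n + 1) • ((n + 1 : ℝ)⁻¹ • r n))
      (fun s => (hasDerivAt_expProdError X F s).sub (hasDerivAt_pow_smul n (r n) s))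
      (by simp [expProdError_zero])
      ((hr1.add hm).congr_left fun s => by rw [mul_add, mul_one]; abel)
    have h0 : ((n + 1 : ℝ)⁻¹ • r n) = 0 := by
      refine eq_zero_of_pow_smul_isBigO (n := n + 1) (IsBigO.mono ?_ nhdsWithin_le_nhds)
      refine ((h.trans (isBigO_pow_pow (m := n + 2) (by omega))).sub hd).congr_left fun s => ?_
      abel
    have h1 : r n = 0 := (smul_eq_zero.1 h0).resolve_left (by positivity)
    simpa [h1] using hr1

/-- Undoing the conjugation by e^{sX} transfers the decay of R to G - X. -/
theorem defectCoeff_eq_zero (X : Fin L → A) (F : List (Fin L × ℝ)) {p : ℕ}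
    (h : expProdError X F =O[𝓝 0] fun s : ℝ => s ^ (p + 1)) :
    ∀ k < p, defectCoeff X F k = 0 := by
  refine (hasTaylor_defect p X F).coeff_eq_zero le_rfl ?_
  have h1 := ((isBigO_exp_smul_one (∑ l, X l) 1).mul (errorGenerator_isBigO X F h)).mul
    (isBigO_exp_smul_one (∑ l, X l) (-1))
  refine (h1.congr_right fun s => by ring).congr_left fun s => ?_
  rw [errorGenerator, mul_one, mul_neg_one]
  simp only [mul_assoc, exp_smul_mul_neg, mul_one]
  rw [← mul_assoc, exp_smul_mul_neg, one_mul]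

/-- The two leading terms of the multiplicative error of a product formula of order `p`. -/
theorem expProdError_expansion (X : Fin L → A) (F : List (Fin L × ℝ)) {p : ℕ} (hp : 1 ≤ p)
    (h : expProdError X F =O[𝓝 0] fun s : ℝ => s ^ (p + 1)) :
    (fun s => expProdError X F s - s ^ (p + 1) • ((p + 1 : ℝ)⁻¹ • wordSum X (genCoeff F) p) -
      s ^ (p + 2) • ((p + 2 : ℝ)⁻¹ • (wordSum X (genCoeff F) (p + 1) -
        ⁅∑ l, X l, wordSum X (genCoeff F) p⁆))) =O[𝓝 0] fun s : ℝ => s ^ (p + 3) := by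
  have hR := errorGenerator_isBigO X F h
  have hD := defectCoeff_eq_zero X F h
  have hDn : ∀ n, n ≠ 0 → defectCoeff X F n = wordSum X (genCoeff F) n := fun n hn => by
    rw [defectCoeff, if_neg hn, add_zero]
  have hT := hasTaylor_errorGenerator (p + 2) X F
  set r : ℕ → A := fun n => ∑ m ∈ Finset.range (n + 1),
      (((m.factorial : ℝ)⁻¹) • (-adCLM (∑ l, X l)) ^ m) (defectCoeff X F (n - m)) with hr
  have hrp : r p = wordSum X (genCoeff F) p := by
    rw [hr]
    dsimp only
    rw [Finset.sum_range_succ', Finset.sum_eq_zero fun m hm => by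
      have := Finset.mem_range.1 hm
      rw [hD _ (by omega), map_zero], zero_add, Nat.sub_zero, hDn p (by omega)]
    simp
  -- Since the defect vanishes below degree p, only the powers 0 and 1 of -ad X contribute to degree
  -- p + 1.
  have hrp1 : r (p + 1) = wordSum X (genCoeff F) (p + 1) -
      ⁅∑ l, X l, wordSum X (genCoeff F) p⁆ := by
    rw [hr]
    dsimp only
    rw [Finset.sum_range_succ', Finset.sum_range_succ', Finset.sum_eq_zero fun m hm => by
      have := Finset.mem_range.1 hm
      rw [hD _ (by omega), map_zero], zero_add, Nat.sub_zero, hDn (p + 1) (by omega),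
      zero_add, Nat.add_sub_cancel, hDn p (by omega)]
    simp only [Nat.factorial_one, Nat.factorial_zero, Nat.cast_one, inv_one, one_smul, pow_one,
      pow_zero, neg_apply, adCLM_apply, one_apply_eq_self]
    abel
  have hr0 := hT.coeff_eq_zero (m := p) (by omega) hR
  rw [← hrp1, ← hrp]
  have hr1 : (fun s => errorGenerator X F s - s ^ p • r p - s ^ (p + 1) • r (p + 1)) =O[𝓝 0]
      fun s : ℝ => s ^ (p + 2) := by
    refine IsBigO.congr_left hT fun s => ?_
    rw [Finset.sum_range_succ, Finset.sum_range_succ, Finset.sum_eq_zero fun k hk => by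
      rw [hr0 k (Finset.mem_range.1 hk), smul_zero], zero_add, sub_sub]
  -- R M = O(s^{2p+1}), which is O(s^{p+2}) because p ≥ 1.
  have hm : (fun s => errorGenerator X F s * expProdError X F s) =O[𝓝 0]
      fun s : ℝ => s ^ (p + 2) := by
    have := hR.mul h
    simp only [← pow_add] at this
    exact this.trans (isBigO_pow_pow (by omega))
  have hd2 : ∀ s : ℝ, HasDerivAt (fun s : ℝ => s ^ (p + 2) • ((p + 2 : ℝ)⁻¹ • r (p + 1)))
      (s ^ (p + 1) • r (p + 1)) s := fun s => by
    have h := hasDerivAt_pow_smul (p + 1) (r (p + 1)) s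
    have e : (((p + 1 : ℕ) : ℝ) + 1) = p + 2 := by push_cast; ring
    rwa [e] at h
  refine isBigO_pow_succ_of_deriv (n := p + 2)
    (fun s => ((hasDerivAt_expProdError X F s).sub (hasDerivAt_pow_smul p (r p) s)).sub (hd2 s))
    (by simp [expProdError_zero]) ((hr1.add hm).congr_left fun s => ?_)
  rw [mul_add, mul_one]
  abel

theorem expProdError_sub_leading_isBigO (X : Fin L → A) (F : List (Fin L × ℝ)) {p : ℕ}
    (hp : 1 ≤ p) (h : expProdError X F =O[𝓝 0] fun s : ℝ => s ^ (p + 1)) :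
    (fun s => expProdError X F s - s ^ (p + 1) • ((p + 1 : ℝ)⁻¹ • wordSum X (genCoeff F) p))
      =O[𝓝 0] fun s : ℝ => s ^ (p + 2) :=
  (((expProdError_expansion X F hp h).trans (isBigO_pow_pow (by omega : p + 2 ≤ p + 3))).add
    (isBigO_pow_smul (p + 2) _)).congr_left fun _ => sub_add_cancel _ _

/-- Consistency kills the constant term of R, so M' = R (1 + M) is O(s). -/
theorem expProdError_isBigO_sq (X : Fin L → A) (F : List (Fin L × ℝ))
    (h : (F.map fun x => x.2 • X x.1).sum = ∑ l, X l) :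
    expProdError X F =O[𝓝 0] fun s : ℝ => s ^ 2 := by
  have h1 : defectCoeff X F 0 = 0 := by
    rw [defectCoeff, wordSum_genCoeff_zero, h, if_pos rfl, add_neg_cancel]
  have hR : errorGenerator X F =O[𝓝 0] fun s : ℝ => s ^ 1 := by
    refine IsBigO.congr_left (hasTaylor_errorGenerator 1 X F) fun s => ?_
    simp [h1]
  have hM : (fun s => 1 + expProdError X F s) =O[𝓝 0] fun _ : ℝ => (1 : ℝ) := by
    have hc : Continuous fun s => 1 + expProdError X F s :=
      continuous_const.add (continuous_iff_continuousAt.2 fun s =>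
        (hasDerivAt_expProdError X F s).continuousAt)
    exact (hc.tendsto 0).isBigO_one ℝ
  refine isBigO_pow_succ_of_deriv (hasDerivAt_expProdError X F) (expProdError_zero X F) ?_
  simpa using hR.mul hM

end Expansion

/-! ### Leading defects of approximate exponentials and time symmetry. -/

section Order

variable {A : Type*} [NormedRing A] [NormedAlgebra ℝ A]

/-- `f(s) = e^{a s X} + s^m D + O(s^{m+1})` as `s → 0`. -/
def ApproxExp (X : A) (m : ℕ) (a : ℝ) (D : A) (f : ℝ → A) : Prop :=
  (fun s => f s - exp ((s * a) • X) - s ^ m • D) =O[𝓝 0] fun s : ℝ => s ^ (m + 1)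

theorem ApproxExp.comp_mul {X D : A} {m : ℕ} {f : ℝ → A} (hf : ApproxExp X m 1 D f) (c : ℝ) :
    ApproxExp X m c (c ^ m • D) (fun s => f (c * s)) := by
  have ht : Tendsto (fun s : ℝ => c * s) (𝓝 0) (𝓝 0) := by
    simpa using (continuous_const_mul c).tendsto (0 : ℝ)
  have h1 := IsBigO.comp_tendsto hf ht
  have h2 : ((fun s : ℝ => s ^ (m + 1)) ∘ fun s : ℝ => c * s) =O[𝓝 0]
      fun s : ℝ => s ^ (m + 1) := by
    refine IsBigO.of_bound (|c| ^ (m + 1)) (Eventually.of_forall fun s => ?_)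
    simp [mul_pow]
  refine (h1.trans h2).congr_left fun s => ?_
  simp only [Function.comp_apply, mul_one, smul_smul, mul_pow]
  rw [mul_comm c s, mul_comm (c ^ m)]

variable [CompleteSpace A]

/-- Exponentials are 1 + O(s), so leading defects simply add. -/
theorem ApproxExp.mul {X D D' : A} {m : ℕ} (hm : 1 ≤ m) {a b : ℝ} {f g : ℝ → A}
    (hf : ApproxExp X m a D f) (hg : ApproxExp X m b D' g) :
    ApproxExp X m (a + b) (D + D') (fun s => f s * g s) := by
  have hD : ∀ D : A, (fun s : ℝ => s ^ m • D) =O[𝓝 0] fun _ : ℝ => (1 : ℝ) := fun D => by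
    simpa using (isBigO_pow_smul m D).trans (isBigO_pow_pow (Nat.zero_le m))
  have hg1 : g =O[𝓝 0] fun _ : ℝ => (1 : ℝ) := by
    have h := ((hg.trans (isBigO_pow_pow (Nat.zero_le _))).congr_right fun s => pow_zero s).add
      ((isBigO_exp_smul_one X b).add (hD D'))
    exact h.congr_left fun s => by abel
  have t1 := (IsBigO.mul hf hg1).congr_right fun s => mul_one _
  have t2 := (((isBigO_exp_smul_one X a).add (hD D)).mul hg).congr_right fun s => one_mul _
  have t3 := (isBigO_pow_smul m D).mul (isBigO_exp_smul_sub_one X b)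
  have t4 := (isBigO_exp_smul_sub_one X a).mul (isBigO_pow_smul m D')
  have t5 := ((isBigO_pow_smul m D).mul (isBigO_pow_smul m D')).congr_right
    fun s => (pow_add s m m).symm
  have t5' := t5.trans (isBigO_pow_pow (m := m + 1) (by omega))
  have t3' := t3.congr_right fun s => (pow_succ s m).symm
  have t4' := t4.congr_right fun s => (pow_succ' s m).symm
  refine ((((t1.add t2).add t3').add t4').add t5').congr_left fun s => ?_
  rw [mul_add s, exp_add_smul]
  simp only [smul_add, sub_mul, mul_sub, add_mul, mul_one, one_mul]
  abel

variable {L : ℕ}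

theorem expProd_sub_exp (X : Fin L → A) (F : List (Fin L × ℝ)) (s : ℝ) :
    expProd X F s - exp (s • ∑ l, X l) = exp (s • ∑ l, X l) * expProdError X F s := by
  rw [expProdError, mul_sub, ← mul_assoc, exp_smul_mul_neg, one_mul, mul_one]

theorem approxExp_expProd (X : Fin L → A) (F : List (Fin L × ℝ)) {m : ℕ} (hm : 2 ≤ m)
    (h : expProdError X F =O[𝓝 0] fun s : ℝ => s ^ m) :
    ∃ D : A, ApproxExp (∑ l, X l) m 1 D (expProd X F) ∧
      (D = 0 → expProdError X F =O[𝓝 0] fun s : ℝ => s ^ (m + 1)) := by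
  obtain ⟨p, rfl⟩ : ∃ p, m = p + 1 := ⟨m - 1, by omega⟩
  have h2 := expProdError_sub_leading_isBigO X F (p := p) (by omega) h
  set D := (p + 1 : ℝ)⁻¹ • wordSum X (genCoeff F) p
  refine ⟨D, ?_, fun hD => by simpa [hD] using h2⟩
  have h3 := (isBigO_exp_smul_one (∑ l, X l) 1).mul h2
  have h4 := (isBigO_exp_smul_sub_one (∑ l, X l) 1).mul (isBigO_pow_smul (p + 1) D)
  refine ((h3.congr_right fun s => one_mul _).add
    (h4.congr_right fun s => (pow_succ' s (p + 1)).symm)).congr_left fun s => ?_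
  rw [mul_one, expProd_sub_exp, mul_sub, sub_mul, one_mul, sub_add_sub_cancel]

theorem expProdError_isBigO_of_approxExp {X : Fin L → A} {F : List (Fin L × ℝ)} {m : ℕ}
    (h : ApproxExp (∑ l, X l) m 1 0 (expProd X F)) :
    expProdError X F =O[𝓝 0] fun s : ℝ => s ^ (m + 1) := by
  have h1 := (isBigO_exp_smul_one (∑ l, X l) (-1)).mul h
  refine (h1.congr_right fun s => one_mul _).congr_left fun s => ?_
  rw [smul_zero, sub_zero, mul_one, expProd_sub_exp, mul_neg_one, ← mul_assoc, exp_neg_smul_mul,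
    one_mul]

/-- A time-symmetric product formula has even order. -/
theorem expProdError_isBigO_of_reverse_eq (X : Fin L → A) {F : List (Fin L × ℝ)}
    (hF : F.reverse = F) {k : ℕ} (hk : 1 ≤ k)
    (h : expProdError X F =O[𝓝 0] fun s : ℝ => s ^ (2 * k)) :
    expProdError X F =O[𝓝 0] fun s : ℝ => s ^ (2 * k + 1) := by
  obtain ⟨D, h1, h2⟩ := approxExp_expProd X F (by omega) h
  refine h2 ?_
  -- U(s) U(-s) = 1 exactly, while its defect is D + (-1)^{2k} D = 2D; hence D = 0.
  have h3 := h1.mul (by omega) (h1.comp_mul (-1))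
  have h4 : (fun s : ℝ => s ^ (2 * k) • (-(D + D))) =O[𝓝 0] fun s : ℝ => s ^ (2 * k + 1) := by
    refine IsBigO.congr_left h3 fun s => ?_
    have h5 := expProd_mul_reverse X F s
    rw [hF] at h5
    dsimp only
    rw [neg_one_mul, h5, add_neg_cancel, mul_zero, zero_smul, exp_zero, sub_self, zero_sub,
      Even.neg_one_pow (even_two_mul k), one_smul, smul_neg]
  have h6 := eq_zero_of_pow_smul_isBigO (h4.mono nhdsWithin_le_nhds)
  have h7 : (2 : ℝ) • D = 0 := by rw [two_smul, ← neg_eq_zero, h6]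
  exact (smul_eq_zero.1 h7).resolve_left two_ne_zero

end Order

/-! ### Suzuki's recursion as lists of factors, and its order. -/

section Suzuki

/-- The list of factors of `e^{a s X₁} ⋯ e^{a s X_L}`. -/
def forwardFactors (L : ℕ) (a : ℝ) : List (Fin L × ℝ) := List.ofFn fun l => (l, a)

/-- Rescaling of time in a list of factors. -/
def scaleFactors {L : ℕ} (c : ℝ) (F : List (Fin L × ℝ)) : List (Fin L × ℝ) :=
  F.map fun x => (x.1, c * x.2)

/-- The list of factors of the Suzuki formula of order `2k`. -/
def suzukiFactors (L : ℕ) : ℕ → List (Fin L × ℝ)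
  | 0 => []
  | 1 => forwardFactors L (1 / 2) ++ (forwardFactors L (1 / 2)).reverse
  | k + 2 =>
      (scaleFactors (suzukiParam (k + 2)) (suzukiFactors L (k + 1)) ++
        scaleFactors (suzukiParam (k + 2)) (suzukiFactors L (k + 1))) ++
      scaleFactors (1 - 4 * suzukiParam (k + 2)) (suzukiFactors L (k + 1)) ++
      (scaleFactors (suzukiParam (k + 2)) (suzukiFactors L (k + 1)) ++
        scaleFactors (suzukiParam (k + 2)) (suzukiFactors L (k + 1)))

theorem scaleFactors_reverse {L : ℕ} (c : ℝ) (F : List (Fin L × ℝ)) :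
    (scaleFactors c F).reverse = scaleFactors c F.reverse := by
  simp [scaleFactors]

theorem suzukiFactors_reverse (L : ℕ) : ∀ k, (suzukiFactors L k).reverse = suzukiFactors L k
  | 0 => rfl
  | 1 => by simp [suzukiFactors]
  | k + 2 => by
    simp only [suzukiFactors, List.reverse_append, scaleFactors_reverse,
      suzukiFactors_reverse L (k + 1), List.append_assoc]

theorem countP_forwardFactors (L : ℕ) (a : ℝ) (l : Fin L) :
    (forwardFactors L a).countP (fun x => x.1 = l) ≤ 1 := by
  have h : ((forwardFactors L a).map Prod.fst).Nodup := by
    rw [forwardFactors, List.map_ofFn]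
    exact List.nodup_ofFn.2 fun i j h => h
  have h2 := List.nodup_iff_count_le_one.1 h l
  rw [List.count, List.countP_map] at h2
  refine (List.countP_mono_left fun x _ hx => ?_).trans h2
  simpa using hx

/-- The bounds are chosen before L; this is what makes the final constant depend on p alone. -/
theorem exists_suzukiFactors_bound (k : ℕ) : ∃ b : ℝ, 1 ≤ b ∧ ∃ K : ℕ, ∀ L : ℕ,
    (∀ x ∈ suzukiFactors L k, |x.2| ≤ b) ∧
      ∀ l, (suzukiFactors L k).countP (fun x => x.1 = l) ≤ K := by
  induction k using Nat.strong_induction_on with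
  | _ k ih =>
    match k with
    | 0 => exact ⟨1, le_rfl, 0, fun L => by simp [suzukiFactors]⟩
    | 1 =>
      refine ⟨1, le_rfl, 2, fun L => ⟨?_, fun l => ?_⟩⟩
      · simp only [suzukiFactors, forwardFactors, List.mem_append, List.mem_reverse, or_self,
          List.mem_ofFn]
        rintro x ⟨l, rfl⟩
        simp only
        rw [abs_of_pos] <;> norm_num
      · rw [suzukiFactors, List.countP_append, List.countP_reverse]
        have := countP_forwardFactors L (1 / 2) l
        omega
    | k + 2 =>
      obtain ⟨b, hb, K, hK⟩ := ih (k + 1) (by omega)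
      set c := 1 + |suzukiParam (k + 2)| + |1 - 4 * suzukiParam (k + 2)|
      have hc1 : |suzukiParam (k + 2)| ≤ c := by
        have := abs_nonneg (1 - 4 * suzukiParam (k + 2))
        simp only [c]; linarith
      have hc2 : |1 - 4 * suzukiParam (k + 2)| ≤ c := by
        have := abs_nonneg (suzukiParam (k + 2))
        simp only [c]; linarith
      have hc : 1 ≤ c := by
        have h1 := abs_nonneg (suzukiParam (k + 2))
        have h2 := abs_nonneg (1 - 4 * suzukiParam (k + 2))
        simp only [c]; linarith
      have hs : ∀ L d, |d| ≤ c → ∀ x ∈ scaleFactors d (suzukiFactors L (k + 1)),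
          |x.2| ≤ c * b := by
        intro L d hd x hx
        obtain ⟨y, hy, rfl⟩ := List.mem_map.1 hx
        rw [abs_mul]
        exact mul_le_mul hd ((hK L).1 y hy) (abs_nonneg _) (by linarith)
      have hn : ∀ L d l, (scaleFactors d (suzukiFactors L (k + 1))).countP (fun x => x.1 = l) ≤
          K := by
        intro L d l
        rw [scaleFactors, List.countP_map]
        exact (hK L).2 l
      refine ⟨c * b, one_le_mul_of_one_le_of_one_le hc hb, 5 * K, fun L => ⟨?_, fun l => ?_⟩⟩
      · intro x hx
        simp only [suzukiFactors, List.mem_append, or_self] at hx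
        rcases hx with (hx | hx) | hx
        · exact hs L _ hc1 x hx
        · exact hs L _ hc2 x hx
        · exact hs L _ hc1 x hx
      · simp only [suzukiFactors, List.countP_append]
        have h1 := hn L (suzukiParam (k + 2)) l
        have h2 := hn L (1 - 4 * suzukiParam (k + 2)) l
        omega

variable {L : ℕ} {A : Type*} [NormedRing A] [NormedAlgebra ℝ A]

theorem expProd_scaleFactors (X : Fin L → A) (F : List (Fin L × ℝ)) (c s : ℝ) :
    expProd X (scaleFactors c F) s = expProd X F (c * s) := by
  simp only [expProd, scaleFactors, List.map_map, Function.comp_def]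
  congr 1
  refine List.map_congr_left fun x _ => ?_
  congr 2
  ring

theorem expProd_forwardFactors (X : Fin L → A) (a s : ℝ) :
    expProd X (forwardFactors L a) s = (List.ofFn fun l => exp ((s * a) • X l)).prod := by
  simp [expProd, forwardFactors, List.map_ofFn, Function.comp_def]

theorem expProd_suzukiFactors (X : Fin L → A) (k : ℕ) (s : ℝ) :
    expProd X (suzukiFactors L (k + 2)) s =
      (expProd X (suzukiFactors L (k + 1)) (suzukiParam (k + 2) * s) *
        expProd X (suzukiFactors L (k + 1)) (suzukiParam (k + 2) * s)) *
      expProd X (suzukiFactors L (k + 1)) ((1 - 4 * suzukiParam (k + 2)) * s) *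
      (expProd X (suzukiFactors L (k + 1)) (suzukiParam (k + 2) * s) *
        expProd X (suzukiFactors L (k + 1)) (suzukiParam (k + 2) * s)) := by
  simp only [suzukiFactors, expProd_append, expProd_scaleFactors]

/-- With q = 4^{1/(2k+3)} one has 1 - 4 p = -q p, and the odd power of this is -4 p^{2k+3}. -/
theorem suzukiParam_condition (k : ℕ) :
    4 * suzukiParam (k + 2) ^ (2 * k + 3) +
      (1 - 4 * suzukiParam (k + 2)) ^ (2 * k + 3) = 0 := by
  set q : ℝ := (4 : ℝ) ^ (1 / (2 * ((k + 2 : ℕ) : ℝ) - 1)) with hq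
  have he : (2 * ((k + 2 : ℕ) : ℝ) - 1) = ((2 * k + 3 : ℕ) : ℝ) := by push_cast; ring
  have hq1 : q ^ (2 * k + 3) = 4 := by
    rw [hq, he, one_div]
    exact Real.rpow_inv_natCast_pow (by norm_num) (by omega)
  have hq4 : q < 4 := by
    rw [hq, he]
    have : (4 : ℝ) ^ (1 / ((2 * k + 3 : ℕ) : ℝ)) < (4 : ℝ) ^ (1 : ℝ) := by
      refine Real.rpow_lt_rpow_of_exponent_lt (by norm_num) ?_
      rw [div_lt_one (by positivity)]
      push_cast
      linarith [(Nat.cast_nonneg k : (0 : ℝ) ≤ k)]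
    simpa using this
  have h4 : (4 - q) ≠ 0 := by linarith
  have hp : suzukiParam (k + 2) = 1 / (4 - q) := rfl
  have h1 : 1 - 4 * suzukiParam (k + 2) = -(q * suzukiParam (k + 2)) := by
    rw [hp]
    field_simp
    ring
  rw [h1, Odd.neg_pow ⟨k + 1, by ring⟩, mul_pow, hq1]
  ring

theorem forwardFactors_sum (X : Fin L → A) (a : ℝ) :
    ((forwardFactors L a).map fun x => x.2 • X x.1).sum = a • ∑ l, X l := by
  simp [forwardFactors, List.map_ofFn, Function.comp_def, List.sum_ofFn, Finset.smul_sum]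

variable [CompleteSpace A]

/-- The Suzuki formula with parameter `k` has order `2k`. -/
theorem expProdError_suzukiFactors (X : Fin L → A) : ∀ k : ℕ,
    expProdError X (suzukiFactors L (k + 1)) =O[𝓝 0] fun s : ℝ => s ^ (2 * (k + 1) + 1)
  | 0 => by
    refine expProdError_isBigO_of_reverse_eq X (suzukiFactors_reverse L 1) le_rfl
      (expProdError_isBigO_sq X _ ?_)
    rw [suzukiFactors, List.map_append, List.map_reverse, List.sum_append, List.sum_reverse,
      forwardFactors_sum, ← add_smul]
    norm_num
  | k + 1 => by
    refine expProdError_isBigO_of_reverse_eq X (suzukiFactors_reverse L (k + 2)) (by omega) ?_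
    obtain ⟨D, hD, -⟩ := approxExp_expProd X _ (by omega) (expProdError_suzukiFactors X k)
    have h1 := hD.comp_mul (suzukiParam (k + 2))
    have h2 := hD.comp_mul (1 - 4 * suzukiParam (k + 2))
    have h3 := ((h1.mul (by omega) h1).mul (by omega) h2).mul (by omega) (h1.mul (by omega) h1)
    refine expProdError_isBigO_of_approxExp (m := 2 * (k + 1) + 1) ?_
    have e : expProd X (suzukiFactors L (k + 1 + 1)) = _ :=
      funext fun s => expProd_suzukiFactors X k s
    rw [e]
    -- The five time fractions add up to 1, and the five rescaled defects cancel by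
    -- `suzukiParam_condition`.
    convert h3 using 1
    · ring
    · have h4 := suzukiParam_condition k
      rw [← add_smul, ← add_smul, ← add_smul]
      have h5 : (suzukiParam (k + 2) ^ (2 * (k + 1) + 1) + suzukiParam (k + 2) ^ (2 * (k + 1) + 1) +
          (1 - 4 * suzukiParam (k + 2)) ^ (2 * (k + 1) + 1) +
          (suzukiParam (k + 2) ^ (2 * (k + 1) + 1) +
            suzukiParam (k + 2) ^ (2 * (k + 1) + 1))) = 0 := by
        rw [show 2 * (k + 1) + 1 = 2 * k + 3 by ring]
        linarith
      rw [h5, zero_smul]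

end Suzuki

/-! ### The degenerate case of vanishing commutators, and the remainder bound. -/

section Commuting

variable {L : ℕ} {A : Type*} [NormedRing A] [NormedAlgebra ℝ A]

theorem exists_nestedComm_eq_adCLM_pow (X : Fin L → A) (l j : Fin L) (n : ℕ) :
    ∃ w : Fin (n + 1) → Fin L, nestedComm n (fun i => X (w i)) = (adCLM (X l) ^ n) (X j) := by
  induction n with
  | zero => exact ⟨fun _ => j, by simp [nestedComm]⟩
  | succ n ih =>
    obtain ⟨w, hw⟩ := ih
    refine ⟨Fin.cons l w, ?_⟩
    rw [nestedComm_cons, hw, pow_succ', mul_apply_eq_comp, adCLM_apply]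

variable [CompleteSpace A]

theorem generator_of_commute (X : Fin L → A) (hX : ∀ i j, Commute (X i) (X j))
    (F : List (Fin L × ℝ)) (s : ℝ) :
    generator X F s = (F.map fun x => x.2 • X x.1).sum := by
  induction F with
  | nil => rfl
  | cons x F ih =>
    let _ : NormedAlgebra ℚ A := NormedAlgebra.restrictScalars ℚ ℝ A
    have h1 : Commute (X x.1) (F.map fun x => x.2 • X x.1).sum := by
      refine Commute.list_sum_right _ _ fun y hy => ?_
      obtain ⟨z, -, rfl⟩ := List.mem_map.1 hy
      exact (hX _ _).smul_right _
    have h2 := (h1.smul_left (s * x.2)).exp_left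
    rw [generator, ih, h2.eq, mul_assoc, exp_smul_mul_neg, mul_one, List.map_cons, List.sum_cons]

theorem expProdError_eq_zero_of_commute (X : Fin L → A) (hX : ∀ i j, Commute (X i) (X j))
    (F : List (Fin L × ℝ)) (h : (F.map fun x => x.2 • X x.1).sum = ∑ l, X l) (s : ℝ) :
    expProdError X F s = 0 := by
  have h1 : ∀ u, HasDerivAt (expProdError X F) 0 u := fun u => by
    refine (hasDerivAt_expProdError X F u).congr_deriv ?_
    rw [errorGenerator, generator_of_commute X hX, h, sub_self, mul_zero, zero_mul, zero_mul]
  rw [is_const_of_deriv_eq_zero (fun u => (h1 u).differentiableAt) (fun u => (h1 u).deriv) s 0,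
    expProdError_zero]

/-- If `e^{tX}` acts isometrically by conjugation and `[X, [X, Z]] = 0`, then `[X, Z] = 0`. -/
theorem lie_eq_zero_of_lie_lie_eq_zero {X Z : A}
    (hX : ∀ t : ℝ, ‖exp (t • X) * Z * exp (-t • X)‖ ≤ ‖Z‖) (h : ⁅X, ⁅X, Z⁆⁆ = 0) :
    ⁅X, Z⁆ = 0 := by
  let _ : NormedAlgebra ℚ A := NormedAlgebra.restrictScalars ℚ ℝ A
  have hd : ∀ t : ℝ, HasDerivAt (fun t : ℝ => exp (t • adCLM X) Z - t • ⁅X, Z⁆) 0 t := by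
    intro t
    have h1 : HasDerivAt (fun t : ℝ => exp (t • adCLM X) Z) (exp (t • adCLM X) ⁅X, Z⁆) t := by
      have := (hasDerivAt_exp_smul_const (𝕂 := ℝ) (adCLM X) t).clm_apply (hasDerivAt_const t Z)
      simpa using this
    have h2 : exp (t • adCLM X) ⁅X, Z⁆ = ⁅X, Z⁆ := by
      have hc : Commute X ⁅X, Z⁆ := sub_eq_zero.1 (by rwa [Ring.lie_def] at h)
      rw [exp_adCLM_apply, ((hc.smul_left t).exp_left).eq, mul_assoc, exp_smul_mul_neg, mul_one]
    refine (h1.sub ((hasDerivAt_id t).smul_const ⁅X, Z⁆)).congr_deriv ?_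
    rw [h2, one_smul, sub_self]
  -- The conjugate of Z by e^{tX} equals Z + t[X, Z]: linear in t yet bounded.
  have hb : ∀ t : ℝ, ‖t • ⁅X, Z⁆‖ ≤ 2 * ‖Z‖ := by
    intro t
    have hc := is_const_of_deriv_eq_zero (fun u => (hd u).differentiableAt)
      (fun u => (hd u).deriv) t 0
    have h0 : exp ((0 : ℝ) • adCLM X) Z = Z := by
      rw [zero_smul ℝ (adCLM X), exp_zero]
      rfl
    rw [h0, zero_smul, sub_zero, exp_adCLM_apply, sub_eq_iff_eq_add] at hc
    have h3 : t • ⁅X, Z⁆ = exp (t • X) * Z * exp (-t • X) - Z := by rw [hc]; abel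
    rw [h3]
    linarith [norm_sub_le (exp (t • X) * Z * exp (-t • X)) Z, hX t]
  by_contra hne
  have hpos : 0 < ‖⁅X, Z⁆‖ := norm_pos_iff.2 hne
  have h4 := hb ((2 * ‖Z‖ + 1) / ‖⁅X, Z⁆‖)
  rw [norm_smul, norm_div, norm_norm, div_mul_cancel₀ _ hpos.ne',
    Real.norm_of_nonneg (by positivity)] at h4
  linarith

theorem lie_eq_zero_of_adCLM_pow_eq_zero {X : A}
    (hX : ∀ (Z : A) (t : ℝ), ‖exp (t • X) * Z * exp (-t • X)‖ ≤ ‖Z‖) {Z : A} {n : ℕ}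
    (h : (adCLM X ^ (n + 1)) Z = 0) : ⁅X, Z⁆ = 0 := by
  induction n with
  | zero => simpa using h
  | succ n ih =>
    refine ih ?_
    rw [pow_succ', mul_apply_eq_comp, adCLM_apply]
    refine lie_eq_zero_of_lie_lie_eq_zero (hX _) ?_
    rwa [pow_succ', pow_succ', mul_apply_eq_comp, mul_apply_eq_comp, adCLM_apply,
      adCLM_apply] at h

/-- The remainder of a product formula of order `p`, up to a factor that does not depend on the
number of letters. -/
theorem expProdError_remainder_le (X : Fin L → A) (F : List (Fin L × ℝ)) {p : ℕ} (hp : 1 ≤ p)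
    (h : expProdError X F =O[𝓝 0] fun s : ℝ => s ^ (p + 1)) {B : ℝ}
    (hB : ∀ w : List (Fin L), w.length ≤ p + 2 → |genCoeff F w| ≤ B)
    (hα : 0 < nestedCommNormSum (p + 1) X) :
    ∀ᶠ s in 𝓝[>] (0 : ℝ), ‖expProdError X F s -
      s ^ (p + 1) • ((p + 1 : ℝ)⁻¹ • wordSum X (genCoeff F) p)‖ ≤
        (2 * B + 1) * nestedCommNormSum (p + 1) X * s ^ (p + 2) := by
  set α := nestedCommNormSum (p + 1) X
  have hB0 : 0 ≤ B := (abs_nonneg _).trans (hB [] (by simp))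
  set D := (p + 2 : ℝ)⁻¹ • (wordSum X (genCoeff F) (p + 1) -
        ⁅∑ l, X l, wordSum X (genCoeff F) p⁆) with hD
  have hDn : ‖D‖ ≤ 2 * B * α := by
    rw [hD, norm_smul]
    have h1 : ‖((p + 2 : ℝ)⁻¹)‖ ≤ 1 := by
      rw [Real.norm_of_nonneg (by positivity)]
      exact inv_le_one_of_one_le₀ (by linarith [(Nat.cast_nonneg p : (0 : ℝ) ≤ p)])
    have h2 := norm_wordSum_le X (g := genCoeff F) (n := p + 1) (B := B)
      (fun w hw => hB w (by omega))
    have h3 := norm_lie_wordSum_le X (g := genCoeff F) (n := p) (B := B)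
      (fun w hw => hB w (by omega))
    calc _ ≤ 1 * (B * α + B * α) :=
          mul_le_mul h1 ((norm_sub_le _ _).trans (add_le_add h2 h3)) (norm_nonneg _) zero_le_one
      _ = _ := by ring
  obtain ⟨C, hC0, hC⟩ := (expProdError_expansion X F hp h).exists_pos
  -- C may depend on the operators; positivity of α trades C s^{p+3} for α s^{p+2} on a small range
  -- of s, which is the +1 in the constant.
  have hs : ∀ᶠ s in 𝓝[>] (0 : ℝ), C * s < α := by
    have h2 : Tendsto (fun s : ℝ => C * s) (𝓝[>] 0) (𝓝 (C * 0)) :=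
      (tendsto_id.const_mul C).mono_left nhdsWithin_le_nhds
    exact h2.eventually_lt_const (by simpa using hα)
  filter_upwards [hC.bound.filter_mono nhdsWithin_le_nhds, hs, self_mem_nhdsWithin]
    with s h1 h2 h0
  have h0 : 0 < s := h0
  rw [← hD, Real.norm_of_nonneg (by positivity)] at h1
  set R := expProdError X F s - s ^ (p + 1) • ((p + 1 : ℝ)⁻¹ • wordSum X (genCoeff F) p)
  have h3 : ‖R‖ ≤ ‖R - s ^ (p + 2) • D‖ + ‖s ^ (p + 2) • D‖ := by
    simpa using norm_add_le (R - s ^ (p + 2) • D) (s ^ (p + 2) • D)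
  rw [norm_smul, Real.norm_of_nonneg (by positivity)] at h3
  have h4 : C * s ^ (p + 3) ≤ α * s ^ (p + 2) := by
    rw [show C * s ^ (p + 3) = (C * s) * s ^ (p + 2) by ring]
    gcongr
  have h5 : s ^ (p + 2) * ‖D‖ ≤ s ^ (p + 2) * (2 * B * α) := by gcongr
  linarith

end Commuting

/-! ### Translation to the Hamiltonian setting, unitarity, and the observable error. -/

section Operators

variable {E : Type*} [NormedAddCommGroup E] [InnerProductSpace ℂ E] [CompleteSpace E]
variable {L : ℕ}

/-- The skew-adjoint generators `-i Hₗ`. -/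
def letters (H : Fin L → E →L[ℂ] E) (l : Fin L) : E →L[ℂ] E := (-Complex.I) • H l

/-- The list of factors of the product formula of order `p`. -/
def formulaFactors (L p : ℕ) : List (Fin L × ℝ) :=
  if p = 1 then forwardFactors L 1 else suzukiFactors L (p / 2)

theorem evolution_eq (X : E →L[ℂ] E) (t : ℝ) :
    evolution X t = exp (t • ((-Complex.I) • X)) := by
  rw [evolution, ← Complex.coe_smul, smul_smul]
  congr 2
  ring

theorem evolution_total (H : Fin L → E →L[ℂ] E) (t : ℝ) :
    evolution (total H) t = exp (t • ∑ l, letters H l) := by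
  rw [evolution_eq, total, Finset.smul_sum]
  rfl

theorem forwardProd_eq (H : Fin L → E →L[ℂ] E) (a s : ℝ) :
    forwardProd H (s * a) = expProd (letters H) (forwardFactors L a) s := by
  rw [expProd_forwardFactors, forwardProd]
  simp only [evolution_eq, letters]

theorem backwardProd_eq (H : Fin L → E →L[ℂ] E) (a s : ℝ) :
    backwardProd H (s * a) = expProd (letters H) (forwardFactors L a).reverse s := by
  rw [backwardProd, expProd, List.map_reverse, forwardFactors, List.map_ofFn]
  simp only [evolution_eq, letters, Function.comp_def]

theorem suzuki_eq (H : Fin L → E →L[ℂ] E) : ∀ (k : ℕ) (s : ℝ),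
    suzuki H k s = expProd (letters H) (suzukiFactors L k) s
  | 0, s => by simp [suzuki, suzukiFactors, expProd]
  | 1, s => by
    rw [suzuki, suzukiFactors, expProd_append, ← forwardProd_eq, ← backwardProd_eq, mul_one_div]
  | k + 2, s => by
    rw [suzuki, expProd_suzukiFactors, suzuki_eq H (k + 1), suzuki_eq H (k + 1), pow_two]

theorem productFormula_eq (H : Fin L → E →L[ℂ] E) (p : ℕ) (s : ℝ) :
    productFormula H p s = expProd (letters H) (formulaFactors L p) s := by
  rw [productFormula, formulaFactors]
  split_ifs
  · rw [← forwardProd_eq, mul_one]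
  · exact suzuki_eq H _ s

theorem mulError_eq (H : Fin L → E →L[ℂ] E) (p : ℕ) (s : ℝ) :
    mulError H p s = expProdError (letters H) (formulaFactors L p) s := by
  rw [mulError, expProdError, evolution_total, productFormula_eq]

theorem exists_formulaFactors_bound (p : ℕ) : ∃ b : ℝ, 1 ≤ b ∧ ∃ K : ℕ, ∀ L : ℕ,
    (∀ x ∈ formulaFactors L p, |x.2| ≤ b) ∧
      ∀ l, (formulaFactors L p).countP (fun x => x.1 = l) ≤ K := by
  by_cases hp : p = 1
  · refine ⟨1, le_rfl, 1, fun L => ?_⟩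
    rw [formulaFactors, if_pos hp]
    refine ⟨fun x hx => ?_, countP_forwardFactors L 1⟩
    obtain ⟨l, rfl⟩ := List.mem_ofFn.1 hx
    simp
  · simp only [formulaFactors, if_neg hp]
    exact exists_suzukiFactors_bound _

theorem expProdError_formulaFactors {A : Type*} [NormedRing A] [NormedAlgebra ℝ A]
    [CompleteSpace A] {p : ℕ} (hp : p = 1 ∨ (2 ≤ p ∧ Even p)) (X : Fin L → A) :
    expProdError X (formulaFactors L p) =O[𝓝 0] fun s : ℝ => s ^ (p + 1) := by
  rcases hp with rfl | ⟨h2, k, rfl⟩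
  · rw [formulaFactors, if_pos rfl]
    exact expProdError_isBigO_sq X _ (by rw [forwardFactors_sum, one_smul])
  · obtain ⟨k, rfl⟩ : ∃ j, k = j + 1 := ⟨k - 1, by omega⟩
    rw [formulaFactors, if_neg (by omega), show (k + 1 + (k + 1)) / 2 = k + 1 by omega,
      show k + 1 + (k + 1) + 1 = 2 * (k + 1) + 1 by ring]
    exact expProdError_suzukiFactors X k

theorem nestedComm_smul {A : Type*} [NormedRing A] [NormedAlgebra ℂ A] (z : ℂ) (n : ℕ)
    (X : Fin (n + 1) → A) :
    nestedComm n (fun i => z • X i) = z ^ (n + 1) • nestedComm n X := by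
  induction n with
  | zero => simp [nestedComm]
  | succ n ih =>
    rw [nestedComm, nestedComm]
    have h : (Fin.tail fun i => z • X i) = fun i => z • (Fin.tail X) i := rfl
    rw [h, ih, Ring.lie_def, Ring.lie_def, smul_mul_smul_comm, smul_mul_smul_comm,
      ← pow_succ', ← pow_succ, ← smul_sub]

theorem nestedCommNormSum_letters (H : Fin L → E →L[ℂ] E) (n : ℕ) :
    nestedCommNormSum n (letters H) = nestedCommNormSum n H := by
  refine Finset.sum_congr rfl fun w _ => ?_
  simp only [letters]
  rw [nestedComm_smul, norm_smul]
  simp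

theorem leadingError_eq (H : Fin L → E →L[ℂ] E) {p : ℕ} (hp : p = 1 ∨ (2 ≤ p ∧ Even p)) :
    leadingError H p =
      (p + 1 : ℝ)⁻¹ • wordSum (letters H) (genCoeff (formulaFactors L p)) p := by
  have h2 := expProdError_sub_leading_isBigO (letters H) (formulaFactors L p) (p := p) (by omega)
    (expProdError_formulaFactors hp _)
  simp only [← mulError_eq] at h2
  set M := (p + 1 : ℝ)⁻¹ • wordSum (letters H) (genCoeff (formulaFactors L p)) p
  refine Tendsto.limUnder_eq ?_
  have h3 : (fun s : ℝ => (s ^ (p + 1))⁻¹) =O[𝓝[>] 0] fun s : ℝ => (s ^ (p + 1))⁻¹ :=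
    isBigO_refl _ _
  have h4 := h3.smul (h2.mono nhdsWithin_le_nhds)
  have h5 : (fun s : ℝ => (s ^ (p + 1))⁻¹ • mulError H p s - M) =O[𝓝[>] 0] fun s : ℝ => s := by
    refine h4.congr' ?_ ?_
    · filter_upwards [self_mem_nhdsWithin] with s hs
      have hs : s ≠ 0 := (show 0 < s from hs).ne'
      rw [smul_sub, smul_smul, inv_mul_cancel₀ (pow_ne_zero _ hs), one_smul]
    · filter_upwards [self_mem_nhdsWithin] with s hs
      have hs : s ≠ 0 := (show 0 < s from hs).ne'
      rw [smul_eq_mul, pow_succ s (p + 1), ← mul_assoc, inv_mul_cancel₀ (pow_ne_zero _ hs), one_mul]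
  have h6 : Tendsto (fun s : ℝ => s) (𝓝[>] 0) (𝓝 0) := tendsto_id.mono_left nhdsWithin_le_nhds
  simpa using (h5.trans_tendsto h6).add_const M

theorem evolution_mem_unitary {X : E →L[ℂ] E} (hX : IsSelfAdjoint X) (t : ℝ) :
    evolution X t ∈ unitary (E →L[ℂ] E) := by
  let _ : NormedAlgebra ℚ (E →L[ℂ] E) := NormedAlgebra.restrictScalars ℚ ℝ (E →L[ℂ] E)
  refine exp_mem_unitary_of_mem_skewAdjoint ?_
  rw [skewAdjoint.mem_iff, star_smul, hX.star_eq]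
  simp

theorem evolution_add (X : E →L[ℂ] E) (s t : ℝ) :
    evolution X (s + t) = evolution X s * evolution X t := by
  simp only [evolution_eq, exp_add_smul]

theorem evolution_mul_neg (X : E →L[ℂ] E) (s : ℝ) : evolution X s * evolution X (-s) = 1 := by
  simp only [evolution_eq, exp_smul_mul_neg]

theorem isSelfAdjoint_total {H : Fin L → E →L[ℂ] E} (hH : ∀ l, IsSelfAdjoint (H l)) :
    IsSelfAdjoint (total H) := isSelfAdjoint_sum _ fun l _ => hH l

theorem productFormula_mem_unitary {H : Fin L → E →L[ℂ] E} (hH : ∀ l, IsSelfAdjoint (H l))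
    (p : ℕ) (s : ℝ) : productFormula H p s ∈ unitary (E →L[ℂ] E) := by
  rw [productFormula_eq, expProd]
  refine list_prod_mem fun x hx => ?_
  obtain ⟨y, -, rfl⟩ := List.mem_map.1 hx
  rw [letters, ← evolution_eq]
  exact evolution_mem_unitary (hH _) _

/-- If all nested commutators of a given length vanish, the product formula is exact. -/
theorem mulError_eq_zero {H : Fin L → E →L[ℂ] E} (hH : ∀ l, IsSelfAdjoint (H l)) {p : ℕ}
    (hp : p = 1 ∨ (2 ≤ p ∧ Even p)) (h : nestedCommNormSum (p + 1) H = 0) (s : ℝ) :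
    mulError H p s = 0 := by
  rw [mulError_eq]
  refine expProdError_eq_zero_of_commute _ (fun i j => ?_) _ ?_ s
  · obtain ⟨w, hw⟩ := exists_nestedComm_eq_adCLM_pow (letters H) i j (p + 1)
    rw [← nestedCommNormSum_letters, nestedCommNormSum,
      Finset.sum_eq_zero_iff_of_nonneg fun _ _ => norm_nonneg _] at h
    have h1 := norm_eq_zero.1 (h w (Finset.mem_univ _))
    rw [hw] at h1
    have h2 := lie_eq_zero_of_adCLM_pow_eq_zero (fun Z t => ?_) h1
    · exact sub_eq_zero.1 (by rwa [Ring.lie_def] at h2)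
    · rw [letters, ← evolution_eq, ← evolution_eq,
        CStarRing.norm_mul_mem_unitary _ (evolution_mem_unitary (hH i) _),
        CStarRing.norm_mem_unitary_mul _ (evolution_mem_unitary (hH i) _)]
  -- Consistency is read off from the order: as p ≥ 1, the constant term of G - X vanishes.
  · have h1 := defectCoeff_eq_zero (letters H) (formulaFactors L p)
      (expProdError_formulaFactors hp _) 0 (by omega)
    rw [defectCoeff, wordSum_genCoeff_zero, if_pos rfl] at h1
    exact eq_of_sub_eq_zero (by rw [sub_eq_add_neg]; exact h1)

theorem norm_apply_eq_sqrt_absSqExpectation (X : E →L[ℂ] E) (φ : E) :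
    ‖X φ‖ = √(absSqExpectation X φ) := by
  rw [absSqExpectation, mul_apply_eq_comp, ContinuousLinearMap.star_eq_adjoint,
    ContinuousLinearMap.adjoint_inner_right]
  rw [← RCLike.re_eq_complex_re, inner_self_eq_norm_sq, Real.sqrt_sq (norm_nonneg _)]

theorem norm_unitary_apply {U : E →L[ℂ] E} (hU : U ∈ unitary (E →L[ℂ] E)) (φ : E) :
    ‖U φ‖ = ‖φ‖ := by
  rw [norm_apply_eq_sqrt_absSqExpectation, absSqExpectation, (Unitary.mem_iff.1 hU).1,
    one_apply_eq_self, ← RCLike.re_eq_complex_re, inner_self_eq_norm_sq,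
    Real.sqrt_sq (norm_nonneg _)]

theorem star_evolution {X : E →L[ℂ] E} (hX : IsSelfAdjoint X) (t : ℝ) :
    star (evolution X t) = evolution X (-t) := by
  have h := (Unitary.mem_iff.1 (evolution_mem_unitary hX t)).1
  calc star (evolution X t) = star (evolution X t) * (evolution X t * evolution X (-t)) := by
        rw [evolution_mul_neg, mul_one]
    _ = evolution X (-t) := by rw [← mul_assoc, h, one_mul]

theorem norm_heisenberg {H : Fin L → E →L[ℂ] E} (hH : ∀ l, IsSelfAdjoint (H l))
    (O : E →L[ℂ] E) (s : ℝ) : ‖heisenberg H O s‖ = ‖O‖ := by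
  rw [heisenberg,
    CStarRing.norm_mul_mem_unitary _ (evolution_mem_unitary (isSelfAdjoint_total hH) _),
    CStarRing.norm_mem_unitary_mul _ (evolution_mem_unitary (isSelfAdjoint_total hH) _)]

theorem productFormula_eq_evolution_mul (H : Fin L → E →L[ℂ] E) (p : ℕ) (s : ℝ) :
    productFormula H p s = evolution (total H) s * (1 + mulError H p s) := by
  rw [mulError, add_sub_cancel, ← mul_assoc, evolution_mul_neg, one_mul]

theorem norm_lie_apply_le (X Y : E →L[ℂ] E) {φ : E} (hφ : ‖φ‖ = 1) :
    ‖⁅X, Y⁆ φ‖ ≤ 2 * ‖X‖ * ‖Y‖ := by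
  have h1 : ‖⁅X, Y⁆‖ ≤ 2 * ‖X‖ * ‖Y‖ := by
    rw [Ring.lie_def]
    linarith [norm_sub_le (X * Y) (Y * X), norm_mul_le X Y, norm_mul_le Y X,
      mul_comm ‖X‖ ‖Y‖]
  simpa [hφ] using (⁅X, Y⁆.le_opNorm φ).trans
    (mul_le_mul_of_nonneg_right h1 (norm_nonneg φ))

theorem heisenberg_succ (H : Fin L → E →L[ℂ] E) (O : E →L[ℂ] E) (r : ℕ) (s : ℝ) :
    heisenberg H O ((r + 1 : ℕ) * s) =
      evolution (total H) (-s) * heisenberg H O (r * s) * evolution (total H) s := by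
  have h1 : -(((r + 1 : ℕ) : ℝ) * s) = -s + -(r * s) := by push_cast; ring
  have h2 : (((r + 1 : ℕ) : ℝ) * s) = r * s + s := by push_cast; ring
  rw [heisenberg, heisenberg, h1, h2, evolution_add, evolution_add]
  simp only [mul_assoc]

/-- The error in the expectation of an observable caused by one step of the product formula. -/
theorem norm_inner_step_le {H : Fin L → E →L[ℂ] E} (hH : ∀ l, IsSelfAdjoint (H l)) (p : ℕ)
    (O : E →L[ℂ] E) {ψ : E} (hψ : ‖ψ‖ = 1) (r : ℕ) {s : ℝ} (hs : 0 ≤ s) :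
    ‖inner ℂ ψ ((heisenberg H O ((r + 1 : ℕ) * s) -
      star (productFormula H p s) * heisenberg H O (r * s) * productFormula H p s) ψ)‖ ≤
      √(absSqExpectation ⁅heisenberg H O ((r + 1 : ℕ) * s), leadingError H p⁆ ψ) * s ^ (p + 1) +
        2 * ‖O‖ * ‖remainder H p s‖ := by
  set Q := heisenberg H O ((r + 1 : ℕ) * s)
  set W := 1 + mulError H p s
  have hV := evolution_mem_unitary (isSelfAdjoint_total hH) (-s)
  have hW : W ∈ unitary (E →L[ℂ] E) := by
    have : W = evolution (total H) (-s) * productFormula H p s := by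
      simp only [W, mulError]; abel
    rw [this]
    exact mul_mem hV (productFormula_mem_unitary hH p s)
  have h1 : star (productFormula H p s) * heisenberg H O (r * s) * productFormula H p s =
      star W * Q * W := by
    rw [productFormula_eq_evolution_mul, star_mul, star_evolution (isSelfAdjoint_total hH)]
    simp only [Q, heisenberg_succ, mul_assoc]
    rfl
  -- Unitarity of W rewrites Q as W†WQ, leaving W† times a commutator; that W† is later moved past
  -- the norm.
  have h2 : Q - star W * Q * W = -(star W * ⁅Q, mulError H p s⁆) := by
    have h3 : ⁅Q, mulError H p s⁆ = Q * W - W * Q := by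
      simp only [W, Ring.lie_def]
      noncomm_ring
    rw [h3, mul_sub, ← mul_assoc, ← mul_assoc, (Unitary.mem_iff.1 hW).1, one_mul]
    abel
  have h4 : mulError H p s = (s ^ (p + 1) : ℝ) • leadingError H p + remainder H p s := by
    rw [remainder]; abel
  have h5 : ⁅Q, mulError H p s⁆ ψ = (s ^ (p + 1) : ℝ) • ⁅Q, leadingError H p⁆ ψ +
      ⁅Q, remainder H p s⁆ ψ := by
    have : ⁅Q, mulError H p s⁆ = (s ^ (p + 1) : ℝ) • ⁅Q, leadingError H p⁆ +
        ⁅Q, remainder H p s⁆ := by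
      rw [h4]
      simp only [← adCLM_apply, map_add, map_smul]
    rw [this]
    rfl
  rw [h1, h2, neg_apply, inner_neg_right, norm_neg, mul_apply_eq_comp]
  refine (norm_inner_le_norm _ _).trans ?_
  rw [hψ, one_mul, norm_unitary_apply (Unitary.star_mem hW), h5]
  refine (norm_add_le _ _).trans (add_le_add ?_ ?_)
  · rw [norm_smul, Real.norm_of_nonneg (by positivity), mul_comm,
      norm_apply_eq_sqrt_absSqExpectation]
  · refine (norm_lie_apply_le _ _ hψ).trans (le_of_eq ?_)
    rw [norm_heisenberg hH]

theorem observableError_le {H : Fin L → E →L[ℂ] E} (hH : ∀ l, IsSelfAdjoint (H l)) (p : ℕ)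
    (O : E →L[ℂ] E) {s : ℝ} (hs : 0 ≤ s) (r : ℕ) : ∀ ψ : E, ‖ψ‖ = 1 →
    observableError H p O ψ r s ≤
      ∑ k ∈ Finset.Icc 1 r, √(scrambling H p O ψ r s k) * s ^ (p + 1) +
        2 * r * ‖O‖ * ‖remainder H p s‖ := by
  induction r with
  | zero =>
    intro ψ _
    simp [observableError, heisenberg, evolution]
  | succ r ih =>
    intro ψ hψ
    set U := productFormula H p s with hU
    have hUψ : ‖U ψ‖ = 1 := by
      rw [norm_unitary_apply (productFormula_mem_unitary hH p s), hψ]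
    have h1 := ih (U ψ) hUψ
    have h2 := norm_inner_step_le hH p O hψ r hs
    rw [← hU] at h2
    have h3 : observableError H p O ψ (r + 1) s ≤
        ‖inner ℂ ψ ((heisenberg H O ((r + 1 : ℕ) * s) -
          star U * heisenberg H O (r * s) * U) ψ)‖ + observableError H p O (U ψ) r s := by
      -- The first product-formula step is split off; the other r steps act on Uψ, where the
      -- induction hypothesis applies.
      have h4 : heisenberg H O ((r + 1 : ℕ) * s) - star U ^ (r + 1) * O * U ^ (r + 1) =
          (heisenberg H O ((r + 1 : ℕ) * s) - star U * heisenberg H O (r * s) * U) +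
          star U * ((heisenberg H O (r * s) - star U ^ r * O * U ^ r) * U) := by
        rw [pow_succ' (star U), pow_succ U]
        noncomm_ring
      rw [observableError, observableError, ← hU, h4, add_apply, inner_add_right]
      refine (norm_add_le _ _).trans (le_of_eq ?_)
      congr 2
      rw [mul_apply_eq_comp, mul_apply_eq_comp, ContinuousLinearMap.star_eq_adjoint,
        ContinuousLinearMap.adjoint_inner_right]
    rw [Finset.sum_Icc_succ_top (by omega)]
    -- For k ≤ r, U^{r+1-k} ψ = U^{r-k} (Uψ), so the intermediate states agree.
    have h5 : ∑ k ∈ Finset.Icc 1 r, √(scrambling H p O ψ (r + 1) s k) * s ^ (p + 1) =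
        ∑ k ∈ Finset.Icc 1 r, √(scrambling H p O (U ψ) r s k) * s ^ (p + 1) := by
      refine Finset.sum_congr rfl fun k hk => ?_
      rw [scrambling, scrambling, Nat.succ_sub (Finset.mem_Icc.1 hk).2, pow_succ]
      rfl
    have h6 : scrambling H p O ψ (r + 1) s (r + 1) =
        absSqExpectation ⁅heisenberg H O ((r + 1 : ℕ) * s), leadingError H p⁆ ψ := by
      rw [scrambling, Nat.sub_self, pow_zero, one_apply_eq_self]
    rw [h5, h6]
    push_cast at h2 h3 ⊢
    linarith

end Operators

end Trotter

end

/-! ### Assembly of the three claims. -/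

theorem mainTheorem2 (p : ℕ) (hp : p = 1 ∨ (2 ≤ p ∧ Even p)) :
    ∃ C : ℝ, ∀ L : ℕ, ∃ c : (Fin (p + 1) → Fin L) → ℝ,
      ∀ (E : Type*) [NormedAddCommGroup E] [InnerProductSpace ℂ E] [CompleteSpace E]
        (H : Fin L → E →L[ℂ] E), (∀ l, IsSelfAdjoint (H l)) →
        Trotter.leadingError H p =
            ∑ j : Fin (p + 1) → Fin L,
              ((-Complex.I) ^ (p + 1) * (c j : ℂ)) • Trotter.nestedComm p (fun i => H (j i)) ∧
        (∀ δ : ℝ, Trotter.productFormula H p δ =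
            Trotter.evolution (Trotter.total H) δ *
              (1 + (δ ^ (p + 1) • Trotter.leadingError H p + Trotter.remainder H p δ))) ∧
        (∀ᶠ δ in 𝓝[>] (0 : ℝ), ‖Trotter.remainder H p δ‖ ≤
            C * Trotter.nestedCommNormSum (p + 1) H * δ ^ (p + 2)) ∧
        ∀ (O : E →L[ℂ] E), IsSelfAdjoint O → ∀ ψ : E, ‖ψ‖ = 1 →
          ∀ (r : ℕ) (δ : ℝ), 0 ≤ δ →
            Trotter.observableError H p O ψ r δ ≤
              ∑ k ∈ Finset.Icc 1 r, √(Trotter.scrambling H p O ψ r δ k) * δ ^ (p + 1) +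
                2 * r * ‖O‖ * ‖Trotter.remainder H p δ‖ := by
  obtain ⟨b, hb, K, hbK⟩ := Trotter.exists_formulaFactors_bound p
  -- This is 2B + 1, where B bounds the coefficients of words of length at most p + 2: one B each
  -- for w_{p+1} and [X, w_p].
  refine ⟨2 * (b + (p + 2 : ℕ) * b ^ (p + 2)) ^ ((p + 2) * K) + 1, fun L =>
    ⟨fun j => (p + 1 : ℝ)⁻¹ * Trotter.genCoeff (Trotter.formulaFactors L p) (List.ofFn j), ?_⟩⟩
  intro E _ _ _ H hH
  have hlead := Trotter.leadingError_eq H hp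
  refine ⟨?_, fun δ => ?_, ?_, fun O _ ψ hψ r δ hδ => Trotter.observableError_le hH p O hδ r ψ hψ⟩
  · rw [hlead, Trotter.wordSum, Finset.smul_sum]
    refine Finset.sum_congr rfl fun j _ => ?_
    simp only [Trotter.letters]
    rw [Trotter.nestedComm_smul, smul_smul, mul_comm (_ ^ _), mul_smul (_ : ℂ), Complex.coe_smul]
  · rw [Trotter.remainder, add_sub_cancel, ← Trotter.productFormula_eq_evolution_mul]
  · have hα : 0 ≤ Trotter.nestedCommNormSum (p + 1) H :=
      Finset.sum_nonneg fun _ _ => norm_nonneg _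
    -- If α = 0, the bound demands an exactly zero remainder, so this case needs exactness of the
    -- formula.
    rcases hα.eq_or_lt with h0 | hpos
    · have hM : ∀ s, Trotter.mulError H p s = 0 := Trotter.mulError_eq_zero hH hp h0.symm
      have hl : Trotter.leadingError H p = 0 := by
        rw [Trotter.leadingError]
        refine Tendsto.limUnder_eq ?_
        simp only [hM, smul_zero]
        exact tendsto_const_nhds
      refine Eventually.of_forall fun δ => ?_
      rw [Trotter.remainder, hM, hl, ← h0]
      simp
    · rw [← Trotter.nestedCommNormSum_letters] at hpos ⊢
      refine (Trotter.expProdError_remainder_le (Trotter.letters H) (Trotter.formulaFactors L p)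
        (by omega) (Trotter.expProdError_formulaFactors hp _)
        (fun w hw => Trotter.abs_genCoeff_le hb (p + 2) K _ (hbK L).1 (hbK L).2 w hw) hpos).mono
        fun δ hδ => ?_
      rw [Trotter.remainder, hlead, Trotter.mulError_eq]
      exact hδ
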